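/- Let $K$ be a field. An operad over $K$ consists of vector spaces $\mathcal P(n)$, $n\ge 0$, right actions of the symmetric groups $S_n$ on $\mathcal P(n)$, bilinear partial compositions $\circ_i:\mathcal P(n)\otimes\mathcal P(m)\to\mathcal P(n+m-1)$, $1\le i\le n$, and a unit $\mathbf 1\in\mathcal P(1)$, satisfying the nested and disjoint associativity, unit and equivariance axioms. A morphism of operads is a family of linear $S_n$-equivariant maps $a(n):\mathcal P(n)\to\mathcal Q(n)$ that preserves the unit and all partial compositions. Let $\mathcal{RT}(n)$ be the $K$-vector space with basis the rooted trees with vertices labelled by $1,\dots,n$. For labelled rooted trees $S$ (with $n$ vertices) and $T$ (with $m$ vertices), a vertex $v$ of $S$, the set $E(S,v)$ of edges of $S$ arriving at $v$ (edges being oriented towards the root), and a map $f$ from $E(S,v)$ to the vertex set $v(T)$ of $T$, let $S\circ_v^f T$ be the tree obtained by replacing the vertex $v$ of $S$ by $T$ and connecting each edge $e\in E(S,v)$ to the vertex $f(e)$ of $T$, with labels shifted as follows: $v-1$ is added to the labels of $T$ and $m-1$ is added to the labels of $S$ greater than $v$. Let $f_0$ be the constant map equal to the root of $T$. In both operads below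 the unit is the tree with one vertex and $S_n$ acts by permuting labels. * The pre-Lie operad $\mathcal O_{PL}$ has $\mathcal O_{PL}(n)=\mathcal{RT}(n)$ and $S\circ_v T=\sum_{f:E(S,v)\to v(T)}S\circ_v^f T$. * The NAP operad $\mathcal O_{NAP}$ has $\mathcal O_{NAP}(n)=\mathcal{RT}(n)$ and $S\circ_v T=S\circ_v^{f_0}T$. For $\lambda\in K$, let $\mathcal O^\lambda_n=\prod_{\mu\in(\mathbb N^*)^n}\mathcal O_{n,\mu}$, where $\mathbb N^*=\{1,2,\dots\}$ and $\mathcal O_{n,\mu}$ has basis the weighted trees $(t,\mu)$, $t$ a rooted tree labelled by $1,\dots,n$, the vertex $v$ having weight $|v|=\mu_v$. Put $|T|=\sum_{v}|v|$ and $d(T)=\sum_{v}|v|\,h(v)$, where $h(v)$ is the height of $v$, that is, its distance to the root. For weighted trees $S,T$ and a vertex $v$ of $S$, set $$S\circ_{v,\lambda}T=\sum_{f:E(S,v)\to v(T)}\lambda^{d(S\circ_v^fT)-d(S\circ_v^{f_0}T)}\,S\circ_v^fT\quad\text{if }|T|=|v|,\qquad S\circ_{v,\lambda}T=0\quad\text{otherwise}$$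 (with $\lambda^0=1$ also for $\lambda=0$), where the vertices of $S\circ_v^fT$ keep the weights they have in $S$ or $T$. These compositions extend componentwise to the products $\mathcal O^\lambda_n$. The unit is the sum over all $k\ge1$ of the one-vertex trees of weight $k$, and $S_n$ acts by permuting the labels together with the weights. **Theorem.** The linear map $i:\mathcal O_{PL}\to\mathcal O^1$ defined on a labelled rooted tree $t$ with $n$ vertices by $i(t)=\sum_{\mu\in(\mathbb N^*)^n}(t,\mu)$ is a morphism of operads from the pre-Lie operad to $\mathcal O^1$. Similarly, the linear map $j:\mathcal O_{NAP}\to\mathcal O^0$ defined by $j(t)=\sum_{\mu\in(\mathbb N^*)^n}(t,\mu)$ is a morphism of operads from the NAP operad to $\mathcal O^0$. (In particular these four objects are operads.) -/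

import Mathlib

universe u

open Equiv

/-! ## Operads -/

/-- The numbering of the inputs of a partial composition `a ∘ᵢ b`, where `a` has `n` inputs, `b` has
`m` inputs and the result has `k = n + m - 1` inputs (all numbered from `0`).  The input `j` of `b`
gets the number `i + j`; an input `a ≠ i` of the first operation keeps its number if `a < i` and
gets the number `a + m - 1` if `a > i`. -/
def slot {n m k : ℕ} (h : n + m = k + 1) (i : Fin n) : {a : Fin n // a ≠ i} ⊕ Fin m ≃ Fin k where
  toFun
    | Sum.inl a => if ha : a.1 < i then ⟨a.1, by omega⟩ else
        ⟨a.1 + m - 1, by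
          have h1 := a.2
          have h2 := a.1.2
          rw [Ne, Fin.ext_iff] at h1
          rw [Fin.lt_def] at ha
          omega⟩
    | Sum.inr j => ⟨i + j, by omega⟩
  invFun c :=
    if h1 : c.1 < i.1 then Sum.inl ⟨⟨c, by omega⟩, by rw [Ne, Fin.ext_iff]; simp only; omega⟩
    else if h2 : c.1 < i.1 + m then Sum.inr ⟨c - i, by omega⟩
    else Sum.inl ⟨⟨c + 1 - m, by omega⟩, by rw [Ne, Fin.ext_iff]; simp only; omega⟩
  left_inv := by
    rintro (⟨a, ha⟩ | j)
    · rw [Ne, Fin.ext_iff] at ha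
      by_cases h1 : a < i
      · have h1' : a.1 < i.1 := h1
        simp [h1]
      · have h1' : ¬ a.1 < i.1 := h1
        have h2 : ¬ (a.1 + m - 1 < i.1) := by omega
        have h3 : ¬ (a.1 + m - 1 < i.1 + m) := by omega
        have h4 : a.1 + m - 1 + 1 - m = a.1 := by omega
        simp [h1, h2, h3, h4]
    · simp
  right_inv := by
    intro c
    by_cases h1 : c.1 < i.1
    · simp [h1, Fin.lt_def]
    · by_cases h2 : c.1 < i.1 + m
      · have h3 : i.1 + (c.1 - i.1) = c.1 := by omega
        simp [h1, h2, h3]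
      · have h3 : ¬ (c.1 + 1 - m < i.1) := by omega
        have h4 : c.1 + 1 - m + m - 1 = c.1 := by omega
        simp [h1, h2, h3, h4, Fin.lt_def]

/-- The block permutation `ρ(σ, τ)` of the equivariance axiom: it permutes the `m` numbers of the
inserted block by `τ`, and moves the blocks (the inserted one and the `n - 1` singletons) by `σ`. -/
def blockPerm {n m k : ℕ} (h : n + m = k + 1) (i : Fin n) (σ : Perm (Fin n)) (τ : Perm (Fin m)) :
    Perm (Fin k) :=
  ((slot h i).symm.trans
    (Equiv.sumCongr (σ.subtypeEquiv fun _ => (σ.injective.ne_iff).symm) τ)).trans (slot h (σ i))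

/-- The data of a (symmetric, `K`-linear) operad: spaces of `n`-ary operations, operators
`x ↦ x.σ` for the permutations `σ`, a unit, and bilinear partial compositions
`∘ᵢ : P(n) ⊗ P(m) → P(n + m - 1)`.  The axioms are in `OperadData.IsOperad`. -/
structure OperadData (K : Type u) [Field K] where
  obj : ℕ → Type u
  [addCommGroup : ∀ n, AddCommGroup (obj n)]
  [module : ∀ n, Module K (obj n)]
  act : ∀ {n : ℕ}, Perm (Fin n) → obj n →ₗ[K] obj n
  one : obj 1
  comp : ∀ {n m k : ℕ}, n + m = k + 1 → Fin n → obj n →ₗ[K] obj m →ₗ[K] obj k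

attribute [instance] OperadData.addCommGroup OperadData.module

/-- The operad axioms.  The position `slot h i (Sum.inr j)` is `i + j` (that is `i + j - 1` when
counting from `1`), and `slot h i (Sum.inl j)` is the position of the old input `j` after insertion
at `i`. -/
structure OperadData.IsOperad {K : Type u} [Field K] (P : OperadData K) : Prop where
  act_one : ∀ {n : ℕ} (x : P.obj n), P.act 1 x = x
  act_mul : ∀ {n : ℕ} (σ τ : Perm (Fin n)) (x : P.obj n), P.act (σ * τ) x = P.act τ (P.act σ x)
  /-- nested associativity: `(a ∘ᵢ b) ∘ c = a ∘ᵢ (b ∘ⱼ c)` -/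
  assoc_nested : ∀ {n m l p q r : ℕ} (hp : n + m = p + 1) (hr : p + l = r + 1)
    (hq : m + l = q + 1) (hr' : n + q = r + 1) (i : Fin n) (j : Fin m)
    (a : P.obj n) (b : P.obj m) (c : P.obj l),
    P.comp hr (slot hp i (Sum.inr j)) (P.comp hp i a b) c =
      P.comp hr' i a (P.comp hq j b c)
  /-- disjoint associativity: for `i < j`, inserting `b` at `i` and `c` at `j` commute -/
  assoc_disjoint : ∀ {n m l p q r : ℕ} (hp : n + m = p + 1) (hr : p + l = r + 1)
    (hq : n + l = q + 1) (hr' : q + m = r + 1) (i j : Fin n) (hij : i < j)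
    (a : P.obj n) (b : P.obj m) (c : P.obj l),
    P.comp hr (slot hp i (Sum.inl ⟨j, hij.ne'⟩)) (P.comp hp i a b) c =
      P.comp hr' (slot hq j (Sum.inl ⟨i, hij.ne⟩)) (P.comp hq j a c) b
  one_comp : ∀ {n : ℕ} (h : 1 + n = n + 1) (a : P.obj n), P.comp h 0 P.one a = a
  comp_one : ∀ {n : ℕ} (i : Fin n) (a : P.obj n), P.comp rfl i a P.one = a
  /-- equivariance; the input `i` of `a.σ` is the input `σ i` of `a` -/
  equivariance : ∀ {n m k : ℕ} (h : n + m = k + 1) (i : Fin n)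
    (σ : Perm (Fin n)) (τ : Perm (Fin m)) (a : P.obj n) (b : P.obj m),
    P.comp h i (P.act σ a) (P.act τ b) = P.act (blockPerm h i σ τ) (P.comp h (σ i) a b)

/-- A morphism of operads from `P` to `Q`: both are operads, and `a` is a family of `K`-linear maps
`a n : P(n) → Q(n)` compatible with the actions of the symmetric groups, the units and the
partial compositions. -/
structure IsOperadMorphism {K : Type u} [Field K] (P Q : OperadData K)
    (a : ∀ n : ℕ, P.obj n →ₗ[K] Q.obj n) : Prop where
  isOperad_source : P.IsOperad
  isOperad_target : Q.IsOperad
  map_act : ∀ {n : ℕ} (σ : Perm (Fin n)) (x : P.obj n), a n (P.act σ x) = Q.act σ (a n x)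
  map_one : a 1 P.one = Q.one
  map_comp : ∀ {n m k : ℕ} (h : n + m = k + 1) (i : Fin n) (x : P.obj n) (y : P.obj m),
    a k (P.comp h i x y) = Q.comp h i (a n x) (a m y)

/-! ## Labelled rooted trees -/

/-- A rooted tree with vertex set `A`, given by its root and its parent function: the edges are
`v → parent v` for `v ≠ root`, and following edges from any vertex leads to the root.
By convention `parent root = root`; this is not an edge. -/
@[ext]
structure RTree (A : Type*) where
  root : A
  parent : A → A
  parent_root : parent root = root
  reach : ∀ v, ∃ k : ℕ, parent^[k] v = root

namespace RTree

variable {A B : Type*}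

/-- Transport of a tree along a bijection of the vertex sets. -/
def relabel (e : A ≃ B) (T : RTree A) : RTree B where
  root := e T.root
  parent b := e (T.parent (e.symm b))
  parent_root := by simp [T.parent_root]
  reach v := by
    obtain ⟨k, hk⟩ := T.reach (e.symm v)
    refine ⟨k, ?_⟩
    have key : ∀ k : ℕ, (fun b => e (T.parent (e.symm b)))^[k] v = e (T.parent^[k] (e.symm v)) := by
      intro k
      induction k with
      | zero => simp
      | succ k ih => rw [Function.iterate_succ_apply', Function.iterate_succ_apply', ih]; simp
    rw [key, hk]

/-- The tree with a single vertex. -/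
def single : RTree (Fin 1) where
  root := 0
  parent := id
  parent_root := rfl
  reach _ := ⟨0, Subsingleton.elim _ _⟩

/-- The edges of `T` arriving at `i`; an edge is represented by its departure vertex. -/
abbrev Edges (T : RTree A) (i : A) : Type _ := {v : A // T.parent v = i ∧ v ≠ T.root}

/-- The height of a vertex: the number of edges from it to the root. -/
def height [DecidableEq A] (T : RTree A) (v : A) : ℕ := Nat.find (T.reach v)

theorem parent_ne_self (T : RTree A) {v : A} (hv : v ≠ T.root) : T.parent v ≠ v := by
  intro h
  obtain ⟨k, hk⟩ := T.reach v
  rw [Function.iterate_fixed h] at hk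
  exact hv hk

section Insert

variable [DecidableEq A] [DecidableEq B]

/-- The root of `T ∘ᵢ S`: the root of `T` if it is not `i`, and the root of `S` otherwise. -/
def insertRoot (T : RTree A) (i : A) (S : RTree B) : {a : A // a ≠ i} ⊕ B :=
  if h : T.root = i then Sum.inr S.root else Sum.inl ⟨T.root, h⟩

/-- The parent function of `T ∘ᵢᶠ S`: the edges of `T` arriving at `i` are connected to `S` through
`f`, the edge of `T` leaving `i` (if any) leaves from the root of `S`, and all other edges of
`T` and `S` are kept. -/
def insertParent (T : RTree A) (i : A) (S : RTree B) (f : T.Edges i → B) :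
    {a : A // a ≠ i} ⊕ B → {a : A // a ≠ i} ⊕ B
  | Sum.inl a =>
      if hp : T.parent a = i then
        if hr : (a : A) = T.root then Sum.inl a else Sum.inr (f ⟨a, hp, hr⟩)
      else Sum.inl ⟨T.parent a, hp⟩
  | Sum.inr b =>
      if b = S.root then
        if hi : i = T.root then Sum.inr b else Sum.inl ⟨T.parent i, T.parent_ne_self hi⟩
      else Sum.inr (S.parent b)

theorem insertParent_root (T : RTree A) (i : A) (S : RTree B) (f : T.Edges i → B) :
    insertParent T i S f (insertRoot T i S) = insertRoot T i S := by
  unfold insertRoot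
  by_cases h : T.root = i
  · simp [h, insertParent]
  · simp [h, insertParent, T.parent_root]

theorem insert_reach (T : RTree A) (i : A) (S : RTree B) (f : T.Edges i → B)
    (v : {a : A // a ≠ i} ⊕ B) :
    ∃ k : ℕ, (insertParent T i S f)^[k] v = insertRoot T i S := by
  have hS : ∀ (k : ℕ) (b : B), S.parent^[k] b = S.root →
      ∃ l : ℕ, (insertParent T i S f)^[l] (Sum.inr b) = Sum.inr S.root := by
    intro k
    induction k with
    | zero =>
      intro b hb
      exact ⟨0, congrArg Sum.inr hb⟩
    | succ k ih =>
      intro b hb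
      by_cases hr : b = S.root
      · exact ⟨0, congrArg Sum.inr hr⟩
      · obtain ⟨l, hl⟩ := ih (S.parent b) hb
        refine ⟨l + 1, ?_⟩
        rw [Function.iterate_succ_apply]
        simpa [insertParent, hr] using hl
  have hT : ∀ (k : ℕ) (a : A), T.parent^[k] a = T.root →
      (∀ ha : a ≠ i, ∃ l : ℕ, (insertParent T i S f)^[l] (Sum.inl ⟨a, ha⟩) = insertRoot T i S) ∧
      (a = i → ∀ b : B, ∃ l : ℕ, (insertParent T i S f)^[l] (Sum.inr b) = insertRoot T i S) := by
    intro k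
    induction k with
    | zero =>
      intro a ha
      have ha : a = T.root := ha
      subst ha
      refine ⟨fun ha => ⟨0, ?_⟩, fun hi b => ?_⟩
      · simp [insertRoot, ha]
      · obtain ⟨k, hk⟩ := S.reach b
        obtain ⟨l, hl⟩ := hS k b hk
        exact ⟨l, by simp [hl, insertRoot, hi]⟩
    | succ k ih =>
      intro a hk
      obtain ⟨ih1, ih2⟩ := ih (T.parent a) hk
      by_cases hr : a = T.root
      · subst hr
        refine ⟨fun ha => ⟨0, ?_⟩, fun hi b => ?_⟩
        · simp [insertRoot, ha]
        · obtain ⟨k, hk⟩ := S.reach b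
          obtain ⟨l, hl⟩ := hS k b hk
          exact ⟨l, by simp [hl, insertRoot, hi]⟩
      · refine ⟨fun ha => ?_, fun hi b => ?_⟩
        · by_cases hp : T.parent a = i
          · obtain ⟨l, hl⟩ := ih2 hp (f ⟨a, hp, hr⟩)
            refine ⟨l + 1, ?_⟩
            rw [Function.iterate_succ_apply]
            simpa [insertParent, hp, hr] using hl
          · obtain ⟨l, hl⟩ := ih1 hp
            refine ⟨l + 1, ?_⟩
            rw [Function.iterate_succ_apply]
            simpa [insertParent, hp] using hl
        · subst hi
          obtain ⟨k', hk'⟩ := S.reach b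
          obtain ⟨l, hl⟩ := hS k' b hk'
          obtain ⟨l', hl'⟩ := ih1 (T.parent_ne_self hr)
          refine ⟨l' + 1 + l, ?_⟩
          rw [Function.iterate_add_apply, hl, Function.iterate_succ_apply]
          simpa [insertParent, hr] using hl'
  rcases v with ⟨a, ha⟩ | b
  · obtain ⟨k, hk⟩ := T.reach a
    exact (hT k a hk).1 ha
  · obtain ⟨k, hk⟩ := T.reach i
    exact (hT k i hk).2 rfl b

/-- The tree `T ∘ᵢᶠ S` obtained by replacing the vertex `i` of `T` by the tree `S` and connecting
each edge `e` of `T` arriving at `i` to the vertex `f e` of `S`. -/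
def insert (T : RTree A) (i : A) (S : RTree B) (f : T.Edges i → B) :
    RTree ({a : A // a ≠ i} ⊕ B) where
  root := insertRoot T i S
  parent := insertParent T i S f
  parent_root := insertParent_root T i S f
  reach := insert_reach T i S f

end Insert

/-- The tree `T ∘ᵢᶠ S` with its vertices numbered `0, …, k - 1`. -/
def insertFin {n m k : ℕ} (h : n + m = k + 1) (T : RTree (Fin n)) (i : Fin n) (S : RTree (Fin m))
    (f : T.Edges i → Fin m) : RTree (Fin k) :=
  (T.insert i S f).relabel (slot h i)

/-- The potential energy `d(T) = ∑ |v| h(v)` of the tree `T` with vertex weights `μ`. -/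
def energy {n : ℕ} (T : RTree (Fin n)) (μ : Fin n → ℕ+) : ℕ := ∑ v, (μ v : ℕ) * T.height v

end RTree

/-- The space `RT(n)` with basis the rooted trees with vertices labelled by `Fin n`. -/
abbrev RT (K : Type u) [Field K] (n : ℕ) : Type u := RTree (Fin n) →₀ K

/-- The right action of the symmetric group by permutation of the labels:
the vertex `v` of `T` has the label `σ⁻¹ v` in `T.σ`. -/
noncomputable def relabelRT (K : Type u) [Field K] {n : ℕ} (σ : Perm (Fin n)) :
    RT K n →ₗ[K] RT K n :=
  Finsupp.lmapDomain K K (RTree.relabel σ⁻¹)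

/-- The pre-Lie operad of rooted trees: `T ∘ᵢ S = ∑_f T ∘ᵢᶠ S`, over all maps `f` from the edges of
`T` arriving at `i` to the vertices of `S`. -/
noncomputable def preLieOperad (K : Type u) [Field K] : OperadData K where
  obj := RT K
  act := relabelRT K
  one := Finsupp.single RTree.single 1
  comp {n m k} h i :=
    Finsupp.linearCombination K fun T : RTree (Fin n) =>
      Finsupp.linearCombination K fun S : RTree (Fin m) =>
        ∑ f : T.Edges i → Fin m, (Finsupp.single (T.insertFin h i S f) 1 : RT K k)

/-- The NAP operad of rooted trees: `T ∘ᵢ S` is the tree `T ∘ᵢᶠ S` for `f` the constant map equal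
to the root of `S`. -/
noncomputable def napOperad (K : Type u) [Field K] : OperadData K where
  obj := RT K
  act := relabelRT K
  one := Finsupp.single RTree.single 1
  comp {n m k} h i :=
    Finsupp.linearCombination K fun T : RTree (Fin n) =>
      Finsupp.linearCombination K fun S : RTree (Fin m) =>
        (Finsupp.single (T.insertFin h i S fun _ => S.root) 1 : RT K k)

/-! ## The operads of weighted rooted trees -/

/-- The `n`-ary component `∏_μ O_{n,μ}`, where `O_{n,μ}` is the space with basis the pairs `(t, μ)`,
`t` a rooted tree labelled by `Fin n`.  So `x μ` is the homogeneous component of `x` of weight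
`μ`, a finite combination of trees which are understood to carry the weights `μ`. -/
abbrev WRT (K : Type u) [Field K] (n : ℕ) : Type u := (Fin n → ℕ+) → RT K n

/-- The weights on the inserted tree `S` in a tree `T ∘ᵢᶠ S` of weights `γ`. -/
def innerWeight {n m k : ℕ} (h : n + m = k + 1) (i : Fin n) (γ : Fin k → ℕ+) : Fin m → ℕ+ :=
  fun b => γ (slot h i (Sum.inr b))

/-- The weights on `T` in a tree `T ∘ᵢᶠ S` of weights `γ`: those of `γ` away from `i`, and the total
weight `|S|` at `i`.  (`Nat.toPNat'` is the identity on positive numbers; the total weight is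
positive since `S` has a vertex.) -/
def outerWeight {n m k : ℕ} (h : n + m = k + 1) (i : Fin n) (γ : Fin k → ℕ+) : Fin n → ℕ+ :=
  fun a => if ha : a = i then (∑ b, (innerWeight h i γ b : ℕ)).toPNat'
    else γ (slot h i (Sum.inl ⟨a, ha⟩))

/-- The bilinear map `(T, S) ↦ ∑_f λ ^ (d(T ∘ᵢᶠ S) - d(T ∘ᵢ^{f₀} S)) • T ∘ᵢᶠ S`, where `f₀` is the
constant map equal to the root of `S` and the energies are those for the weights `γ`; `f₀` gives
the smallest energy, so the subtraction in `ℕ` is a true one. -/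
noncomputable def weightedComp (K : Type u) [Field K] (lam : K) {n m k : ℕ} (h : n + m = k + 1)
    (i : Fin n) (γ : Fin k → ℕ+) : RT K n →ₗ[K] RT K m →ₗ[K] RT K k :=
  Finsupp.linearCombination K fun T : RTree (Fin n) =>
    Finsupp.linearCombination K fun S : RTree (Fin m) =>
      ∑ f : T.Edges i → Fin m,
        Finsupp.single (T.insertFin h i S f)
          (lam ^ ((T.insertFin h i S f).energy γ -
            (T.insertFin h i S fun _ => S.root).energy γ))

/-- The operad `O^λ` of weighted rooted trees.  A composition `(T, α) ∘ᵢ (S, β)` of weighted trees is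
zero unless `|S| = α i`, and then its terms carry the weights `γ` with `β = innerWeight h i γ`
and `α = outerWeight h i γ`; hence the component of `x ∘ᵢ y` of weight `γ` is the one below.
The unit is the sum over all `n ≥ 1` of the trees with a single vertex of weight `n`. -/
noncomputable def weightedOperad (K : Type u) [Field K] (lam : K) : OperadData K where
  obj := WRT K
  act σ := LinearMap.pi fun μ => relabelRT K σ ∘ₗ LinearMap.proj fun v => μ (σ⁻¹ v)
  one := fun _ => Finsupp.single RTree.single 1
  comp {n m k} h i :=
    LinearMap.mk₂ K
      (fun (x : WRT K n) (y : WRT K m) (γ : Fin k → ℕ+) =>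
        weightedComp K lam h i γ (x (outerWeight h i γ)) (y (innerWeight h i γ)))
      (fun _ _ _ => by funext γ; simp)
      (fun _ _ _ => by funext γ; simp)
      (fun _ _ _ => by funext γ; simp)
      (fun _ _ _ => by funext γ; simp)

/-- The linear map `t ↦ ∑_μ (t, μ)`, the sum being over all weightings `μ` of the vertices of `t`:
it is the element of the product whose component of each weight `μ` is `(t, μ)`. -/
noncomputable def allWeights (K : Type u) [Field K] (n : ℕ) : RT K n →ₗ[K] WRT K n :=
  Finsupp.linearCombination K fun t : RTree (Fin n) => fun _ => Finsupp.single t 1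

/-! ## Trees are determined by their parent function -/

namespace RTree

variable {A B C D E : Type*}

/-! The map `f` can be eliminated from the composition. A tree `X` on the composite vertex set
arises by replacing the vertex `i` of `T` by `S` exactly when its parent function satisfies the
conditions `IsInsertion`, and then `f` is read off from `X`. Moreover the constant map to the root
gives energy exactly `d(T) + d(S)`, where `i` carries the weight `|S|` (`energy_insertFin_root`). So
the coefficient of `X` in the composition of `T` and `S` is `λ ^ (d(X) - d(T) - d(S))` if `X` is an
insertion, and `0` otherwise (`weightedComp_single_single_apply`).

In a double composition the intermediate tree is determined by `X`: it is a contraction of `X` or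
its restriction to a block (`outer_unique`, `inner_unique`). The exponents telescope to `d(X) - d(T)
- d(S) - d(U)`, whatever the bracketing. Associativity thus reduces to a statement without
coefficients: an intermediate tree exists for one bracketing if and only if it exists for the other
(`exists_nested_iff`, `exists_disjoint`). Units and equivariance are also checked on insertions.

For `λ = 1` all coefficients are `1`, which is the pre-Lie composition. For `λ = 0` only the maps of
minimal energy survive, and the constant map to the root is the only one (`energy_insertFin_lt`),
which is the NAP composition. Neither depends on the weights, so `allWeights` respects the
compositions. As it is injective, the axioms for the two unweighted operads are pulled back from the
weighted ones. -/

theorem eq_root_of_parent_eq_self (T : RTree A) {v : A} (hv : T.parent v = v) : v = T.root := by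
  by_contra h
  exact T.parent_ne_self h hv

theorem parent_eq_self_iff (T : RTree A) {v : A} : T.parent v = v ↔ v = T.root :=
  ⟨T.eq_root_of_parent_eq_self, fun h => by rw [h, T.parent_root]⟩

/-- The root is recovered as the unique fixed point of the parent function. Equalities of trees are
therefore checked on parents only, and there are finitely many trees on a finite set. -/
theorem parent_injective : Function.Injective (parent : RTree A → A → A) := by
  intro T S h
  refine RTree.ext (S.eq_root_of_parent_eq_self ?_) h
  rw [← h, T.parent_root]

instance [Finite A] : Finite (RTree A) := Finite.of_injective _ parent_injective

noncomputable instance [Finite A] : Fintype (RTree A) := Fintype.ofFinite _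

instance [IsEmpty A] : IsEmpty (RTree A) := ⟨fun T => isEmptyElim T.root⟩

@[simp] theorem relabel_parent (e : A ≃ B) (T : RTree A) (b : B) :
    (T.relabel e).parent b = e (T.parent (e.symm b)) := rfl

@[simp] theorem relabel_root (e : A ≃ B) (T : RTree A) : (T.relabel e).root = e T.root := rfl

@[simp] theorem relabel_refl (T : RTree A) : T.relabel (Equiv.refl A) = T := rfl

theorem relabel_relabel (e : A ≃ B) (e' : B ≃ C) (T : RTree A) :
    (T.relabel e).relabel e' = T.relabel (e.trans e') := rfl

theorem relabel_symm_eq_iff (e : A ≃ B) (T : RTree A) (S : RTree B) :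
    S.relabel e.symm = T ↔ S = T.relabel e := by
  constructor
  · rintro rfl
    rw [relabel_relabel, symm_trans_self, relabel_refl]
  · rintro rfl
    rw [relabel_relabel, self_trans_symm, relabel_refl]

/-! ## Collapsing a block of vertices -/

/-- `p : C → A` collapses the image of the injection `q : B → C` to the point `i`, and is bijective
elsewhere. -/
structure IsCollapse (p : C → A) (q : B → C) (i : A) : Prop where
  proj_emb : ∀ b, p (q b) = i
  emb_injective : Function.Injective q
  exists_emb : ∀ c, p c = i → ∃ b, q b = c
  proj_inj : ∀ c c', p c = p c' → p c ≠ i → c = c'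
  proj_surj : ∀ a, a ≠ i → ∃ c, p c = a

/-- The tree `X` arises from `T` by replacing the vertex `i` by the tree `S`. -/
structure IsInsertion (p : C → A) (q : B → C) (i : A) (T : RTree A) (S : RTree B) (X : RTree C) :
    Prop where
  outer : ∀ c, p c ≠ i → p (X.parent c) = T.parent (p c)
  inner : ∀ b, b ≠ S.root → X.parent (q b) = q (S.parent b)
  base : p (X.parent (q S.root)) = T.parent i
  -- If `i` is the root of `T`, `base` only says that the parent of the root of `S` lies in the
  -- block; this condition makes it the root of `X`.
  base_of_root : T.parent i = i → X.parent (q S.root) = q S.root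

namespace IsInsertion

variable {p : C → A} {q : B → C} {i : A} {T T' : RTree A} {S S' : RTree B} {X X' : RTree C}

theorem root_of_eq (h : IsInsertion p q i T S X) (hi : T.root = i) : X.root = q S.root :=
  (X.eq_root_of_parent_eq_self (h.base_of_root (by rw [← hi, T.parent_root]))).symm

theorem proj_root (h : IsInsertion p q i T S X) (hc : IsCollapse p q i) : p X.root = T.root := by
  by_cases hi : T.root = i
  · rw [h.root_of_eq hi, hc.proj_emb, hi]
  · obtain ⟨c, hcr⟩ := hc.proj_surj _ hi
    have h1 : p (X.parent c) = p c := by rw [h.outer c (by rwa [hcr]), hcr, T.parent_root]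
    rw [← hcr, X.eq_root_of_parent_eq_self (hc.proj_inj _ _ h1 (by rwa [h1, hcr]))]

theorem root_of_proj_eq (h : IsInsertion p q i T S X) (hc : IsCollapse p q i) {c : C}
    (hci : p c ≠ i) (hr : p c = T.root) : c = X.root :=
  hc.proj_inj _ _ (by rw [h.proj_root hc, hr]) hci

/-- The root of `S` is the only vertex of the block that is fixed or whose parent lies outside the
block. This criterion does not involve `T` or `S`, so `X` alone determines the root of `S`. -/
theorem proj_parent_emb_root (h : IsInsertion p q i T S X) (hc : IsCollapse p q i) {b : B} :
    X.parent (q b) = q b ∨ p (X.parent (q b)) ≠ i ↔ b = S.root := by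
  constructor
  · intro hb
    by_contra hne
    rw [h.inner b hne] at hb
    rcases hb with hb | hb
    · exact S.parent_ne_self hne (hc.emb_injective hb)
    · exact hb (hc.proj_emb _)
  · rintro rfl
    by_cases hi : T.parent i = i
    · exact Or.inl (h.base_of_root hi)
    · exact Or.inr (by rwa [h.base])

theorem inner_unique (h : IsInsertion p q i T S X) (h' : IsInsertion p q i T' S' X)
    (hc : IsCollapse p q i) : S = S' := by
  have hr : S.root = S'.root :=
    (h'.proj_parent_emb_root hc).1 ((h.proj_parent_emb_root hc).2 rfl)
  apply parent_injective
  funext b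
  by_cases hb : b = S.root
  · rw [hb, S.parent_root, hr, S'.parent_root]
  · exact hc.emb_injective (by rw [← h.inner b hb, h'.inner b (hr ▸ hb)])

/-- Once `S` is known, every parent in `T` is the image of a parent in `X`: that of the root of `S`
for the vertex `i`, that of the unique preimage for the others. -/
theorem outer_unique (h : IsInsertion p q i T S X) (h' : IsInsertion p q i T' S' X)
    (hc : IsCollapse p q i) : T = T' := by
  have hS := h.inner_unique h' hc
  subst hS
  apply parent_injective
  funext a
  by_cases ha : a = i
  · rw [ha, ← h.base, h'.base]
  · obtain ⟨c, rfl⟩ := hc.proj_surj a ha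
    rw [← h.outer c ha, h'.outer c ha]

/-- The only freedom in an insertion is where the children of `i` are attached; all other parents
are forced by `T` and `S`. -/
theorem eq_of_parent_eq (h : IsInsertion p q i T S X) (h' : IsInsertion p q i T S X')
    (hc : IsCollapse p q i)
    (hp : ∀ c, p c ≠ i → T.parent (p c) = i → X.parent c = X'.parent c) : X = X' := by
  apply parent_injective
  funext c
  by_cases hci : p c = i
  · obtain ⟨b, rfl⟩ := hc.exists_emb c hci
    by_cases hb : b = S.root
    · subst hb
      by_cases hi : T.parent i = i
      · rw [h.base_of_root hi, h'.base_of_root hi]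
      · exact hc.proj_inj _ _ (by rw [h.base, h'.base]) (by rwa [h.base])
    · rw [h.inner b hb, h'.inner b hb]
  · by_cases hi : T.parent (p c) = i
    · exact hp c hci hi
    · exact hc.proj_inj _ _ (by rw [h.outer c hci, h'.outer c hci]) (by rwa [h.outer c hci])

/-- Insertion is invariant under bijections of the vertex sets. -/
theorem of_relabel {A' B' C' : Type*} {p' : C' → A'} {q' : B' → C'} {i' : A'} (eA : A ≃ A')
    (eB : B ≃ B') (eC : C ≃ C') (hi : eA i = i') (hp : ∀ c, eA (p c) = p' (eC c))
    (hq : ∀ b, eC (q b) = q' (eB b))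
    (h : IsInsertion p' q' i' (T.relabel eA) (S.relabel eB) (X.relabel eC)) :
    IsInsertion p q i T S X where
  outer c hci := by
    have := h.outer (eC c) (by rwa [← hp, ← hi, eA.injective.ne_iff])
    simpa [← hp] using this
  inner b hb := by
    have := h.inner (eB b) (by simpa using hb)
    simpa [← hq] using this
  base := by
    have := h.base
    simpa [← hp, ← hq, ← hi] using this
  base_of_root hTi := by
    have := h.base_of_root (by simp [← hi, hTi])
    simpa [← hq] using this

end IsInsertion

/-- Nested insertions: from `(T ∘ᵢ S) ∘ U` to `T ∘ᵢ (S ∘ⱼ U)`.  Here `Y = T ∘ᵢ S`, `Z = S ∘ⱼ U`. -/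
theorem IsInsertion.nested {A M L D Q C : Type*} {p₁ : C → D} {q₁ : L → C} {v : D} {p₂ : D → A}
    {q₂ : M → D} {i : A} {q₁' : Q → C} {p₂' : Q → M} {q₂' : L → Q} {j : M}
    {T : RTree A} {S : RTree M} {U : RTree L} {Y : RTree D} {Z : RTree Q} {X : RTree C}
    (c₁ : IsCollapse p₁ q₁ v) (c₂ : IsCollapse p₂ q₂ i)
    (c₂' : IsCollapse p₂' q₂' j)
    (hv : q₂ j = v) (hpq : ∀ z, p₁ (q₁' z) = q₂ (p₂' z)) (hqq : ∀ u, q₁' (q₂' u) = q₁ u)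
    (hY : IsInsertion p₂ q₂ i T S Y) (hX : IsInsertion p₁ q₁ v Y U X)
    (hZ : IsInsertion p₂' q₂' j S U Z)
    (hZX : ∀ z, p₂' z ≠ j → S.parent (p₂' z) = j → X.parent (q₁' z) = q₁' (Z.parent z)) :
    IsInsertion (p₂ ∘ p₁) q₁' i T Z X := by
  subst hv
  have ne_of : ∀ {m}, m ≠ j → q₂ m ≠ q₂ j := fun h => c₂.emb_injective.ne h
  refine ⟨fun c hc => ?_, fun z hz => ?_, ?_, fun hi => ?_⟩
  · have h1 : p₁ c ≠ q₂ j := fun h => hc (by simp [h, c₂.proj_emb])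
    simp only [Function.comp_apply] at hc ⊢
    rw [hX.outer c h1, hY.outer _ hc]
  · by_cases hzj : p₂' z = j
    · obtain ⟨u, rfl⟩ := c₂'.exists_emb z hzj
      by_cases hu : u = U.root
      · subst hu
        have hj : j ≠ S.root := fun h => hz (hZ.root_of_eq h.symm).symm
        have h1 : p₁ (X.parent (q₁ U.root)) = q₂ (S.parent j) := by rw [hX.base, hY.inner j hj]
        rw [hqq]
        refine c₁.proj_inj _ _ ?_ ?_
        · rw [h1, hpq, hZ.base]
        · rw [h1]
          exact ne_of (S.parent_ne_self hj)
      · rw [hqq, hX.inner u hu, hZ.inner u hu, hqq]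
    · have hzr : p₂' z ≠ S.root := fun h => hz (hZ.root_of_proj_eq c₂' hzj h)
      by_cases hp : S.parent (p₂' z) = j
      -- Edges of `S` arriving at `j` are the only ones whose attachment in `Z` is a choice; `hZX`
      -- says that `Z` makes the choice seen in `X`.
      · exact hZX z hzj hp
      · have h1 : p₁ (X.parent (q₁' z)) = q₂ (S.parent (p₂' z)) := by
          rw [hX.outer _ (by rw [hpq]; exact ne_of hzj), hpq, hY.inner _ hzr]
        refine c₁.proj_inj _ _ ?_ ?_
        · rw [h1, hpq, hZ.outer z hzj]
        · rw [h1]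
          exact ne_of hp
  · by_cases hj : S.root = j
    · rw [hZ.root_of_eq hj, hqq, Function.comp_apply, hX.base, ← hj, hY.base]
    · have h1 := hZ.proj_root c₂'
      rw [Function.comp_apply, hX.outer _ (by rw [hpq, h1]; exact ne_of hj), hpq, h1, hY.base]
  · by_cases hj : S.root = j
    · rw [hZ.root_of_eq hj, hqq]
      apply hX.base_of_root
      rw [← hj]
      exact hY.base_of_root hi
    · have h1 := hZ.proj_root c₂'
      have h2 : p₁ (X.parent (q₁' Z.root)) = q₂ S.root := by
        rw [hX.outer _ (by rw [hpq, h1]; exact ne_of hj), hpq, h1, hY.base_of_root hi]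
      refine c₁.proj_inj _ _ ?_ ?_
      · rw [h2, hpq, h1]
      · rw [h2]
        exact ne_of hj

/-- Nested insertions: from `T ∘ᵢ (S ∘ⱼ U)` to `(T ∘ᵢ S) ∘ U`.  Here `Y = T ∘ᵢ S`, `Z = S ∘ⱼ U`. -/
theorem IsInsertion.nested_symm {A M L D Q C : Type*} {p₁ : C → D} {q₁ : L → C} {v : D}
    {p₂ : D → A} {q₂ : M → D} {i : A} {q₁' : Q → C} {p₂' : Q → M} {q₂' : L → Q} {j : M}
    {T : RTree A} {S : RTree M} {U : RTree L} {Y : RTree D} {Z : RTree Q} {X : RTree C}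
    (c₁' : IsCollapse (p₂ ∘ p₁) q₁' i) (c₂ : IsCollapse p₂ q₂ i)
    (c₂' : IsCollapse p₂' q₂' j)
    (hv : q₂ j = v) (hpq : ∀ z, p₁ (q₁' z) = q₂ (p₂' z)) (hqq : ∀ u, q₁' (q₂' u) = q₁ u)
    (hZ : IsInsertion p₂' q₂' j S U Z) (hX : IsInsertion (p₂ ∘ p₁) q₁' i T Z X)
    (hY : IsInsertion p₂ q₂ i T S Y)
    (hYX : ∀ c, p₂ (p₁ c) ≠ i → T.parent (p₂ (p₁ c)) = i → p₁ (X.parent c) = Y.parent (p₁ c)) :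
    IsInsertion p₁ q₁ v Y U X := by
  subst hv
  -- The edge leaving the block of `i` starts at the root of `Z`, which lies over the root of `S`
  -- whether or not `j` is that root; both cases below use this.
  have key : ∀ z, z = Z.root → p₂' z = S.root → p₁ (X.parent (q₁' z)) = Y.parent (q₂ S.root) := by
    intro z hz hzr
    subst hz
    by_cases hi : T.parent i = i
    · rw [hX.base_of_root hi, hY.base_of_root hi, hpq, hzr]
    · have h1 : p₂ (p₁ (X.parent (q₁' Z.root))) = T.parent i := hX.base
      exact c₂.proj_inj _ _ (by rw [h1, hY.base]) (by rwa [h1])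
  refine ⟨fun c hc => ?_, fun u hu => ?_, ?_, fun hv => ?_⟩
  · by_cases hci : p₂ (p₁ c) = i
    · obtain ⟨z, rfl⟩ := c₁'.exists_emb c hci
      rw [hpq] at hc ⊢
      have hzj : p₂' z ≠ j := fun h => hc (by rw [h])
      by_cases hz : p₂' z = S.root
      · rw [key z (hZ.root_of_proj_eq c₂' hzj hz) hz, hz]
      · have hz' : z ≠ Z.root := fun h => hz (by rw [h, hZ.proj_root c₂'])
        rw [hX.inner z hz', hpq, hZ.outer z hzj, hY.inner _ hz]
    · by_cases hp : T.parent (p₂ (p₁ c)) = i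
      · exact hYX c hci hp
      · have h1 : p₂ (p₁ (X.parent c)) = T.parent (p₂ (p₁ c)) := hX.outer c hci
        exact c₂.proj_inj _ _ (by rw [h1, hY.outer _ hci]) (by rwa [h1])
  · have h1 := hZ.inner u hu
    have h2 : q₂' u ≠ Z.root := fun h => by
      rw [← Z.parent_eq_self_iff, h1] at h
      exact U.parent_ne_self hu (c₂'.emb_injective h)
    rw [← hqq, hX.inner _ h2, h1, hqq]
  · by_cases hj : S.root = j
    · rw [← hqq, key _ (hZ.root_of_eq hj).symm (by rw [c₂'.proj_emb, hj]), hj]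
    · have h1 : q₂' U.root ≠ Z.root := fun h => hj (by rw [← hZ.proj_root c₂', ← h, c₂'.proj_emb])
      rw [← hqq, hX.inner _ h1, hpq, hZ.base, hY.inner j (Ne.symm hj)]
  · have hv := Y.eq_root_of_parent_eq_self hv
    have hi : T.root = i := by rw [← hY.proj_root c₂, ← hv, c₂.proj_emb]
    have hj : S.root = j := c₂.emb_injective (by rw [hv, hY.root_of_eq hi])
    have := hX.base_of_root (by rw [← hi, T.parent_root])
    rwa [hZ.root_of_eq hj, hqq] at this

/-- Disjoint insertions: from `(T ∘ᵢ S) ∘ⱼ U` to `(T ∘ⱼ U) ∘ᵢ S`.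
Here `Y = T ∘ᵢ S`, `Y' = T ∘ⱼ U`. -/
theorem IsInsertion.disjoint {A M L D D' C : Type*} {p₁ : C → D} {q₁ : L → C} {v : D}
    {p₂ : D → A} {q₂ : M → D} {i : A} {p₁' : C → D'} {q₁' : M → C} {v' : D'} {p₂' : D' → A}
    {q₂' : L → D'} {j : A}
    {T : RTree A} {S : RTree M} {U : RTree L} {Y : RTree D} {Y' : RTree D'} {X : RTree C}
    (c₁ : IsCollapse p₁ q₁ v) (c₂ : IsCollapse p₂ q₂ i)
    (c₁' : IsCollapse p₁' q₁' v') (c₂' : IsCollapse p₂' q₂' j) (hij : i ≠ j)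
    (hv : p₂ v = j) (hv' : p₂' v' = i) (hpp : ∀ c, p₂ (p₁ c) = p₂' (p₁' c))
    (hpq : ∀ b, p₁ (q₁' b) = q₂ b) (hpq' : ∀ u, p₁' (q₁ u) = q₂' u)
    (hY : IsInsertion p₂ q₂ i T S Y) (hX : IsInsertion p₁ q₁ v Y U X)
    (hY' : IsInsertion p₂' q₂' j T U Y')
    -- The vertex `i` may itself be a child of `j`. In the block over `i`, the edge of `T` leaving
    -- `i` starts at the root of `S` only, so the attachment is compared at that vertex alone.
    (hYX : ∀ c, p₂ (p₁ c) ≠ j → (p₂ (p₁ c) = i → c = q₁' S.root) → T.parent (p₂ (p₁ c)) = j →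
      p₁' (X.parent c) = Y'.parent (p₁' c)) :
    IsInsertion p₁' q₁' v' Y' S X := by
  have q₂v : ∀ b, q₂ b ≠ v := fun b h => hij (by rw [← hv, ← h, c₂.proj_emb])
  have hvY : p₂ (Y.parent v) = T.parent j := by rw [hY.outer v (by rw [hv]; exact hij.symm), hv]
  have hqS : p₁ (X.parent (q₁' S.root)) = Y.parent (q₂ S.root) := by
    rw [hX.outer _ (by rw [hpq]; exact q₂v _), hpq]
  refine ⟨fun c hc => ?_, fun b hb => ?_, ?_, fun hr => ?_⟩
  · have hci : p₂ (p₁ c) ≠ i := fun h => by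
      rw [hpp, ← hv'] at h
      exact hc (c₂'.proj_inj _ _ h (by rw [h, hv']; exact hij))
    by_cases hcj : p₂ (p₁ c) = j
    · obtain ⟨u, rfl⟩ := c₁.exists_emb c
        (c₂.proj_inj _ _ (by rw [hcj, hv]) hci)
      rw [hpq']
      by_cases hu : u = U.root
      · subst hu
        by_cases hTj : T.parent j = j
        · have h1 : Y.parent v = v :=
            c₂.proj_inj _ _ (by rw [hvY, hTj, hv]) (by rw [hvY, hTj]; exact hij.symm)
          rw [hX.base_of_root h1, hY'.base_of_root hTj, hpq']
        · have h1 : p₂' (p₁' (X.parent (q₁ U.root))) = T.parent j := by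
            rw [← hpp, hX.base, hvY]
          exact c₂'.proj_inj _ _ (by rw [h1, hY'.base]) (by rwa [h1])
      · rw [hX.inner u hu, hpq', hY'.inner u hu]
    · by_cases hp : T.parent (p₂ (p₁ c)) = j
      · exact hYX c hcj (fun h => absurd h hci) hp
      · have h1 : p₂' (p₁' (X.parent c)) = T.parent (p₂ (p₁ c)) := by
          rw [← hpp, hX.outer c (fun h => hcj (by rw [h, hv])), hY.outer _ hci]
        refine c₂'.proj_inj _ _ ?_ (by rwa [h1])
        rw [h1, hY'.outer _ (by rwa [← hpp]), ← hpp]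
  · have h1 : p₁ (X.parent (q₁' b)) = q₂ (S.parent b) := by
      rw [hX.outer _ (by rw [hpq]; exact q₂v _), hpq, hY.inner b hb]
    exact c₁.proj_inj _ _ (by rw [h1, hpq]) (by rw [h1]; exact q₂v _)
  · have h1 : p₂ (p₁ (q₁' S.root)) = i := by rw [hpq, c₂.proj_emb]
    have h2 : p₁' (q₁' S.root) = v' := c₁'.proj_emb _
    by_cases hp : T.parent i = j
    · rw [hYX (q₁' S.root) (by rwa [h1]) (fun _ => rfl) (by rwa [h1]), h2]
    · have h3 : p₂' (p₁' (X.parent (q₁' S.root))) = T.parent i := by rw [← hpp, hqS, hY.base]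
      refine c₂'.proj_inj _ _ ?_ (by rwa [h3])
      rw [h3, hY'.outer _ (by rwa [hv']), hv']
  · have h1 : T.parent i = i := by
      have := hY'.outer v' (by rwa [hv'])
      rwa [hr, hv', eq_comm] at this
    rw [hY.base_of_root h1] at hqS
    exact c₁.proj_inj _ _ (by rw [hqS, hpq]) (by rw [hqS]; exact q₂v _)

end RTree

/-! ## Insertions of numbered trees -/

/-- The map that collapses the block of the inputs of `b` in `a ∘ᵢ b` to `i`. -/
def slotProj {n m k : ℕ} (h : n + m = k + 1) (i : Fin n) (c : Fin k) : Fin n :=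
  Sum.elim Subtype.val (fun _ => i) ((slot h i).symm c)

/-- The numbering of the inputs of `b` in `a ∘ᵢ b`. -/
def slotEmb {n m k : ℕ} (h : n + m = k + 1) (i : Fin n) (b : Fin m) : Fin k :=
  slot h i (Sum.inr b)

/-! ### Arithmetic of the positions in a composition -/

section Slot

variable {n m k : ℕ} (h : n + m = k + 1) (i : Fin n)

@[simp] theorem slotProj_slot_inl (a : {a : Fin n // a ≠ i}) :
    slotProj h i (slot h i (Sum.inl a)) = a := by
  simp [slotProj]

@[simp] theorem slotProj_slotEmb (b : Fin m) : slotProj h i (slotEmb h i b) = i := by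
  simp [slotProj, slotEmb]

theorem slotEmb_val (b : Fin m) : (slotEmb h i b : ℕ) = i + b := rfl

theorem slot_inl_val (a : {a : Fin n // a ≠ i}) : (slot h i (Sum.inl a) : ℕ) =
    if (a : Fin n).1 < i then (a : Fin n).1 else (a : Fin n).1 + m - 1 := by
  unfold slot
  simp only [coe_fn_mk, Fin.lt_def]
  split_ifs <;> rfl

/-- Before, inside and after the block, the collapse is given by linear arithmetic. This lets
`omega` prove all identities between iterated collapses. -/
theorem slotProj_val (c : Fin k) :
    ((c : ℕ) < i ∧ (slotProj h i c : ℕ) = c) ∨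
      ((i : ℕ) ≤ c ∧ (c : ℕ) < i + m ∧ (slotProj h i c : ℕ) = i) ∨
        ((i : ℕ) + m ≤ c ∧ (slotProj h i c : ℕ) + m = c + 1) := by
  have hi := i.2
  obtain ⟨⟨a, ha⟩ | b, rfl⟩ := (slot h i).surjective c
  · have ha' : (a : ℕ) ≠ i := fun h' => ha (Fin.ext h')
    rw [slotProj_slot_inl, slot_inl_val]
    split_ifs <;> dsimp only at * <;> omega
  · rw [← slotEmb, slotProj_slotEmb, slotEmb_val]
    omega

theorem slot_slotProj (c : Fin k) (hc : slotProj h i c ≠ i) :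
    slot h i (Sum.inl ⟨slotProj h i c, hc⟩) = c := by
  obtain ⟨a | b, rfl⟩ := (slot h i).surjective c
  · simp
  · exact absurd (slotProj_slotEmb h i b) hc

theorem isCollapse_slot : RTree.IsCollapse (slotProj h i) (slotEmb h i) i where
  proj_emb := slotProj_slotEmb h i
  emb_injective := (slot h i).injective.comp Sum.inr_injective
  exists_emb c hc := by
    obtain ⟨a | b, rfl⟩ := (slot h i).surjective c
    · exact absurd (by simpa using hc) a.2
    · exact ⟨b, rfl⟩
  proj_inj c c' hcc hc := by
    rw [← slot_slotProj h i c hc, ← slot_slotProj h i c' (hcc ▸ hc)]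
    simp only [hcc]
  proj_surj a ha := ⟨slot h i (Sum.inl ⟨a, ha⟩), by simp⟩

end Slot

namespace RTree

section Insertion

variable {n m k : ℕ} (h : n + m = k + 1) (i : Fin n) {T : RTree (Fin n)} {S : RTree (Fin m)}
  {X : RTree (Fin k)}

/-- The tree `X` is of the form `T ∘ᵢᶠ S`. -/
abbrev IsInsertionFin (T : RTree (Fin n)) (S : RTree (Fin m)) (X : RTree (Fin k)) : Prop :=
  IsInsertion (slotProj h i) (slotEmb h i) i T S X

theorem insertFin_parent_slot (f : T.Edges i → Fin m) (x : {a : Fin n // a ≠ i} ⊕ Fin m) :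
    (T.insertFin h i S f).parent (slot h i x) = slot h i (insertParent T i S f x) := by
  simp [insertFin, insert]

theorem isInsertionFin_insertFin (T : RTree (Fin n)) (S : RTree (Fin m)) (f : T.Edges i → Fin m) :
    IsInsertionFin h i T S (T.insertFin h i S f) where
  outer c hc := by
    obtain ⟨a | b, rfl⟩ := (slot h i).surjective c
    · rw [insertFin_parent_slot, slotProj_slot_inl, insertParent]
      split_ifs with hp hr
      · rw [slotProj_slot_inl, hr, T.parent_root]
      · rw [hp]
        exact slotProj_slotEmb h i _
      · rw [slotProj_slot_inl]
    · exact absurd (slotProj_slotEmb h i b) hc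
  inner b hb := by
    rw [slotEmb, insertFin_parent_slot, insertParent, if_neg hb]
    rfl
  base := by
    rw [slotEmb, insertFin_parent_slot, insertParent, if_pos rfl]
    split_ifs with hi
    · rw [hi, T.parent_root]
      exact slotProj_slotEmb h _ _
    · rw [slotProj_slot_inl]
  base_of_root hi := by
    rw [slotEmb, insertFin_parent_slot, insertParent, if_pos rfl,
      dif_pos (T.eq_root_of_parent_eq_self hi)]

theorem edge_of_slotProj {c : Fin k} (hc : slotProj h i c ≠ i)
    (hp : T.parent (slotProj h i c) = i) :
    T.parent (slotProj h i c) = i ∧ slotProj h i c ≠ T.root :=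
  ⟨hp, fun hr => hc ((T.parent_eq_self_iff.2 hr).symm.trans hp)⟩

theorem insertFin_parent_of_edge (f : T.Edges i → Fin m) (c : Fin k) (hc : slotProj h i c ≠ i)
    (hp : T.parent (slotProj h i c) = i) :
    (T.insertFin h i S f).parent c =
      slotEmb h i (f ⟨slotProj h i c, edge_of_slotProj h i hc hp⟩) := by
  conv_lhs => rw [← slot_slotProj h i c hc]
  rw [insertFin_parent_slot, insertParent, dif_pos hp, dif_neg (edge_of_slotProj h i hc hp).2]
  rfl

/-- The value of `f` at an edge is the parent, in the composite tree, of its departure vertex. Hence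
each tree occurs at most once in a composition. -/
theorem insertFin_injective (T : RTree (Fin n)) (S : RTree (Fin m)) :
    Function.Injective fun f : T.Edges i → Fin m => T.insertFin h i S f := by
  intro f g hfg
  funext ⟨a, ha, hr⟩
  have hai : a ≠ i := fun hai => T.parent_ne_self hr (by rw [ha, hai])
  have hs : slotProj h i (slot h i (Sum.inl ⟨a, hai⟩)) = a := slotProj_slot_inl h i _
  have key := congrArg (fun X => X.parent (slot h i (Sum.inl ⟨a, hai⟩))) hfg
  simp only at key
  rw [insertFin_parent_of_edge h i f _ (by rwa [hs]) (by rwa [hs]),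
    insertFin_parent_of_edge h i g _ (by rwa [hs]) (by rwa [hs])] at key
  simpa [hs] using (isCollapse_slot h i).emb_injective key

/-- By `outer`, a vertex over a child of `i` has its parent in the block; the vertex of `S` so named
is the value of `f`. -/
theorem IsInsertion.exists_insertFin (hX : IsInsertionFin h i T S X) :
    ∃ f : T.Edges i → Fin m, T.insertFin h i S f = X := by
  have H : ∀ e : T.Edges i, ∃ b : Fin m, ∀ c, slotProj h i c = e → X.parent c = slotEmb h i b := by
    rintro ⟨a, ha, hr⟩
    have hai : a ≠ i := fun hai => T.parent_ne_self hr (by rw [ha, hai])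
    obtain ⟨c, rfl⟩ := (isCollapse_slot h i).proj_surj a hai
    obtain ⟨b, hb⟩ := (isCollapse_slot h i).exists_emb (X.parent c) (by rw [hX.outer c hai, ha])
    refine ⟨b, fun c' hc' => ?_⟩
    rw [(isCollapse_slot h i).proj_inj c' c hc' (by simpa [hc'] using hai), hb]
  choose f hf using H
  refine ⟨f, (isInsertionFin_insertFin h i T S f).eq_of_parent_eq hX (isCollapse_slot h i)
    fun c hc hp => ?_⟩
  rw [insertFin_parent_of_edge h i f c hc hp, ← hf _ c rfl]

/-- Attachments are prescribed by a function on all vertices of `T`, of which only the values at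
children of `i` matter; this avoids dependence on proofs that a vertex is an edge. -/
theorem exists_insertionFin (T : RTree (Fin n)) (S : RTree (Fin m)) (F : Fin n → Fin m) :
    ∃ X, IsInsertionFin h i T S X ∧ ∀ c, slotProj h i c ≠ i → T.parent (slotProj h i c) = i →
      X.parent c = slotEmb h i (F (slotProj h i c)) :=
  ⟨_, isInsertionFin_insertFin h i T S fun e => F e, insertFin_parent_of_edge h i _⟩

end Insertion

/-! ## Heights and energies -/

section Height

variable {A B C : Type*} [DecidableEq A] [DecidableEq C]

@[simp] theorem height_root (T : RTree A) : T.height T.root = 0 :=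
  (Nat.find_eq_zero _).2 rfl

theorem height_eq_succ (T : RTree A) {v : A} (hv : v ≠ T.root) :
    T.height v = T.height (T.parent v) + 1 :=
  Nat.find_comp_succ (T.reach v) (T.reach (T.parent v)) hv

theorem height_le_succ (T : RTree A) (v : A) : T.height v ≤ T.height (T.parent v) + 1 := by
  by_cases hv : v = T.root
  · simp [hv]
  · rw [T.height_eq_succ hv]

/-- Induction along the edges, from the root. -/
theorem induction_root (T : RTree A) {P : A → Prop} (root : P T.root)
    (step : ∀ v, v ≠ T.root → P (T.parent v) → P v) (v : A) : P v := by
  obtain ⟨k, hk⟩ := T.reach v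
  induction k generalizing v with
  | zero => exact (show v = T.root from hk) ▸ root
  | succ k ih =>
    by_cases hv : v = T.root
    · exact hv ▸ root
    · exact step v hv (ih _ hk)

theorem height_relabel (e : A ≃ C) (T : RTree A) (v : A) :
    (T.relabel e).height (e v) = T.height v := by
  induction v using T.induction_root with
  | root => exact (T.relabel e).height_root.trans T.height_root.symm
  | step v hv ih =>
    rw [T.height_eq_succ hv, height_eq_succ _ (by simpa using hv), ← ih]
    simp

variable {p : C → A} {q : B → C} {i : A} {T : RTree A} {S : RTree B} {X : RTree C}

/-- The collapse sends each edge of `X` to an edge of `T` or to a single vertex, so it cannot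
lengthen a path to the root. -/
theorem IsInsertion.height_proj_le (hX : IsInsertion p q i T S X) (hc : IsCollapse p q i) (c : C) :
    T.height (p c) ≤ X.height c := by
  induction c using X.induction_root with
  | root => simp [hX.proj_root hc]
  | step c hcr ih =>
    rw [X.height_eq_succ hcr]
    by_cases hci : p c = i
    · obtain ⟨b, rfl⟩ := hc.exists_emb c hci
      by_cases hb : b = S.root
      · subst hb
        rw [hX.base, ← hci] at ih
        exact (T.height_le_succ _).trans (by omega)
      · rw [hX.inner b hb] at ih ⊢
        rw [hc.proj_emb] at ih ⊢
        omega
    · rw [hX.outer c hci] at ih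
      exact (T.height_le_succ _).trans (by omega)

/-- With all children of `i` attached to the root of `S`, paths of `T` lift edge by edge to `X`,
that root standing for `i`. The two claims are proved together because a path may pass through `i`.
-/
theorem IsInsertion.height_emb_root_le (hX : IsInsertion p q i T S X) (hc : IsCollapse p q i)
    (h0 : ∀ c, p c ≠ i → T.parent (p c) = i → X.parent c = q S.root) (a : A) :
    (∀ c, p c ≠ i → p c = a → X.height c ≤ T.height a) ∧
      (a = i → X.height (q S.root) ≤ T.height a) := by
  induction a using T.induction_root with
  | root =>
    refine ⟨fun c hci hcr => ?_, fun hi => ?_⟩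
    · simp [hX.root_of_proj_eq hc hci hcr]
    · simp [← hX.root_of_eq hi]
  | step a ha ih =>
    rw [T.height_eq_succ ha]
    refine ⟨fun c hci hca => ?_, fun hi => ?_⟩
    · refine (X.height_le_succ c).trans (Nat.succ_le_succ ?_)
      by_cases hp : T.parent a = i
      · rw [h0 c hci (by rwa [hca])]
        exact ih.2 hp
      · have h1 := hX.outer c hci
        rw [hca] at h1
        exact ih.1 _ (by rwa [h1]) h1
    · refine (X.height_le_succ _).trans (Nat.succ_le_succ ?_)
      have h1 := hX.base
      rw [← hi] at h1
      exact ih.1 _ (by rw [h1, ← hi]; exact T.parent_ne_self ha) h1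

variable [DecidableEq B]

theorem IsInsertion.height_emb_ge (hX : IsInsertion p q i T S X) (hc : IsCollapse p q i) (b : B) :
    T.height i + S.height b ≤ X.height (q b) := by
  induction b using S.induction_root with
  | root => simpa [hc.proj_emb] using hX.height_proj_le hc (q S.root)
  | step b hb ih =>
    have h1 : q b ≠ X.root := by
      rw [Ne, ← X.parent_eq_self_iff, hX.inner b hb]
      exact fun h => S.parent_ne_self hb (hc.emb_injective h)
    rw [X.height_eq_succ h1, S.height_eq_succ hb, hX.inner b hb]
    omega

theorem IsInsertion.height_emb_le (hX : IsInsertion p q i T S X) (hc : IsCollapse p q i)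
    (h0 : ∀ c, p c ≠ i → T.parent (p c) = i → X.parent c = q S.root) (b : B) :
    X.height (q b) ≤ T.height i + S.height b := by
  induction b using S.induction_root with
  | root => simpa using (hX.height_emb_root_le hc h0 i).2 rfl
  | step b hb ih =>
    refine (X.height_le_succ _).trans ?_
    rw [S.height_eq_succ hb, hX.inner b hb]
    omega

end Height

/-! ### Energy of an insertion -/

section Energy

variable {n m k : ℕ} (h : n + m = k + 1) (i : Fin n) {T : RTree (Fin n)} {S : RTree (Fin m)}
  {X : RTree (Fin k)} (γ : Fin k → ℕ+)

theorem outerWeight_ne {a : Fin n} (ha : a ≠ i) :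
    outerWeight h i γ a = γ (slot h i (Sum.inl ⟨a, ha⟩)) :=
  dif_neg ha

theorem outerWeight_slotProj {c : Fin k} (hc : slotProj h i c ≠ i) :
    outerWeight h i γ (slotProj h i c) = γ c := by
  rw [outerWeight_ne h i γ hc, slot_slotProj]

/-- Nonemptiness of the block matters: `Nat.toPNat'` sends an empty total `0` to `1`. -/
theorem outerWeight_self (hm : m ≠ 0) :
    (outerWeight h i γ i : ℕ) = ∑ b, (innerWeight h i γ b : ℕ) := by
  rw [outerWeight, dif_pos rfl, PNat.toPNat'_coe]
  have : NeZero m := ⟨hm⟩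
  exact (Finset.sum_pos (fun b _ => (innerWeight h i γ b).pos) Finset.univ_nonempty)

theorem sum_slot {M : Type*} [AddCommMonoid M] (g : Fin k → M) :
    ∑ c, g c = ∑ a : {a : Fin n // a ≠ i}, g (slot h i (Sum.inl a)) + ∑ b, g (slotEmb h i b) := by
  rw [← (slot h i).sum_comp, Fintype.sum_sum_type]
  rfl

theorem sum_eq_add_sum_ne {M : Type*} [AddCommMonoid M] (g : Fin n → M) :
    ∑ a, g a = g i + ∑ a : {a : Fin n // a ≠ i}, g a :=
  Fintype.sum_eq_add_sum_subtype_ne g i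

/-- The sum of the energies of `T` and `S` is the energy of `T ∘ᵢᶠ S` for `f` constant equal to the
root, computed vertex by vertex. -/
theorem energy_add_energy (T : RTree (Fin n)) (S : RTree (Fin m)) :
    T.energy (outerWeight h i γ) + S.energy (innerWeight h i γ) =
      ∑ a : {a : Fin n // a ≠ i}, (γ (slot h i (Sum.inl a)) : ℕ) * T.height a +
        ∑ b, (γ (slotEmb h i b) : ℕ) * (T.height i + S.height b) := by
  have hm : m ≠ 0 := by
    rintro rfl
    exact S.root.elim0
  have h1 : ∀ a : {a : Fin n // a ≠ i}, (outerWeight h i γ a : ℕ) * T.height a =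
      (γ (slot h i (Sum.inl a)) : ℕ) * T.height a := fun a => by rw [outerWeight_ne h i γ a.2]
  unfold energy
  -- The term `|S| h(i)` of the energy of `T` is distributed over the vertices of `S`.
  rw [sum_eq_add_sum_ne i, outerWeight_self h i γ hm, Finset.sum_mul]
  simp only [h1, mul_add, Finset.sum_add_distrib]
  simp only [innerWeight, slotEmb]
  ring

theorem energy_eq_sum_slot (X : RTree (Fin k)) : X.energy γ =
    ∑ a : {a : Fin n // a ≠ i}, (γ (slot h i (Sum.inl a)) : ℕ) * X.height (slot h i (Sum.inl a)) +
      ∑ b, (γ (slotEmb h i b) : ℕ) * X.height (slotEmb h i b) :=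
  sum_slot h i _

/-- The height bounds hold vertex by vertex. This makes the subtractions in the exponents genuine.
-/
theorem IsInsertion.energy_ge (hX : IsInsertionFin h i T S X) :
    T.energy (outerWeight h i γ) + S.energy (innerWeight h i γ) ≤ X.energy γ := by
  rw [energy_add_energy, energy_eq_sum_slot h i]
  gcongr with a _ b _
  · simpa using hX.height_proj_le (isCollapse_slot h i) (slot h i (Sum.inl a))
  · exact hX.height_emb_ge (isCollapse_slot h i) b

theorem energy_insertFin_root (T : RTree (Fin n)) (S : RTree (Fin m)) :
    (T.insertFin h i S fun _ => S.root).energy γ =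
      T.energy (outerWeight h i γ) + S.energy (innerWeight h i γ) := by
  have hX := isInsertionFin_insertFin h i T S fun _ => S.root
  refine le_antisymm ?_ (hX.energy_ge h i γ)
  have h0 := insertFin_parent_of_edge h i (T := T) (S := S) fun _ => S.root
  rw [energy_add_energy, energy_eq_sum_slot h i]
  gcongr with a _ b _
  · refine (hX.height_emb_root_le (isCollapse_slot h i) h0 a).1 _ ?_ ?_
    · simpa using a.2
    · simp
  · exact hX.height_emb_le (isCollapse_slot h i) h0 b

/-- A child of `i` attached to a vertex of `S` other than the root becomes strictly higher, its
weight is positive, and no other vertex gets lower. -/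
theorem energy_insertFin_lt {f : T.Edges i → Fin m} (hf : f ≠ fun _ => S.root) :
    T.energy (outerWeight h i γ) + S.energy (innerWeight h i γ) <
      (T.insertFin h i S f).energy γ := by
  have hX := isInsertionFin_insertFin h i T S f
  obtain ⟨⟨a, ha, har⟩, he⟩ := Function.ne_iff.1 hf
  have hai : a ≠ i := fun hai => T.parent_ne_self har (by rw [ha, hai])
  rw [energy_add_energy, energy_eq_sum_slot h i]
  refine add_lt_add_of_lt_of_le
    (Finset.sum_lt_sum (fun a _ => ?_) ⟨⟨a, hai⟩, Finset.mem_univ _, ?_⟩)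
    (Finset.sum_le_sum fun b _ => ?_)
  · gcongr
    simpa using hX.height_proj_le (isCollapse_slot h i) (slot h i (Sum.inl a))
  · refine Nat.mul_lt_mul_of_pos_left ?_ (γ _).pos
    set c := slot h i (Sum.inl ⟨a, hai⟩) with hcdef
    have hs : slotProj h i c = a := slotProj_slot_inl h i _
    have hcr : c ≠ (T.insertFin h i S f).root := fun hc => har (by
      rw [← hs, hc, hX.proj_root (isCollapse_slot h i)])
    rw [height_eq_succ _ hcr, insertFin_parent_of_edge h i f c (by rwa [hs]) (by rwa [hs])]
    have h1 := hX.height_emb_ge (isCollapse_slot h i)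
      (f ⟨slotProj h i c, edge_of_slotProj h i (by rwa [hs]) (by rwa [hs])⟩)
    have h2 := T.height_eq_succ har
    rw [ha] at h2
    have h3 : 0 < S.height
        (f ⟨slotProj h i c, edge_of_slotProj h i (by rwa [hs]) (by rwa [hs])⟩) := by
      rw [height_eq_succ]
      · omega
      · simpa only [hs] using he
    simp only
    omega
  · gcongr
    exact hX.height_emb_ge (isCollapse_slot h i) b

theorem energy_relabel (e : Perm (Fin n)) (T : RTree (Fin n)) (μ : Fin n → ℕ+) :
    (T.relabel e).energy μ = T.energy fun v => μ (e v) := by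
  unfold energy
  rw [← Equiv.sum_comp e]
  simp [height_relabel]

end Energy

end RTree

/-! ## The composition of weighted trees -/

open scoped Classical in
-- Used for the sum over intermediate trees `y` in a double composition: at most one of them leads
-- to the given result.
theorem sum_ite_mul_ite {ι R : Type*} [Fintype ι] [Semiring R] {P Q : ι → Prop} {A B : ι → R}
    {W : R} (huniq : ∀ y y', Q y → Q y' → y = y') (hW : ∀ y, P y → Q y → A y * B y = W) :
    ∑ y, (if P y then A y else 0) * (if Q y then B y else 0) =
      if ∃ y, P y ∧ Q y then W else 0 := by
  split_ifs with hex
  · obtain ⟨y, hP, hQ⟩ := hex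
    rw [Fintype.sum_eq_single y, if_pos hP, if_pos hQ, hW y hP hQ]
    intro z hz
    rw [if_neg fun hQ' => hz (huniq z y hQ' hQ), mul_zero]
  · refine Finset.sum_eq_zero fun y _ => ?_
    by_cases hP : P y
    · rw [if_neg fun hQ => hex ⟨y, hP, hQ⟩, mul_zero]
    · rw [if_neg hP, zero_mul]

section WeightedComp

variable {K : Type u} [Field K] (lam : K) {n m k : ℕ} (h : n + m = k + 1) (i : Fin n)
  (γ : Fin k → ℕ+)

open RTree

theorem weightedComp_single_single (T : RTree (Fin n)) (S : RTree (Fin m)) :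
    weightedComp K lam h i γ (Finsupp.single T 1) (Finsupp.single S 1) =
      ∑ f : T.Edges i → Fin m, Finsupp.single (T.insertFin h i S f)
        (lam ^ ((T.insertFin h i S f).energy γ -
          (T.energy (outerWeight h i γ) + S.energy (innerWeight h i γ)))) := by
  simp [weightedComp, energy_insertFin_root]

open scoped Classical in
theorem weightedComp_single_single_apply (T : RTree (Fin n)) (S : RTree (Fin m))
    (X : RTree (Fin k)) :
    weightedComp K lam h i γ (Finsupp.single T 1) (Finsupp.single S 1) X =
      if IsInsertionFin h i T S X then
        lam ^ (X.energy γ - (T.energy (outerWeight h i γ) + S.energy (innerWeight h i γ)))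
      else 0 := by
  rw [weightedComp_single_single, Finsupp.finsetSum_apply]
  split_ifs with hX
  · obtain ⟨f, rfl⟩ := hX.exists_insertFin
    rw [Fintype.sum_eq_single f, Finsupp.single_eq_same]
    intro g hg
    exact Finsupp.single_eq_of_ne fun hfg => hg (insertFin_injective h i T S hfg).symm
  · refine Finset.sum_eq_zero fun f _ => Finsupp.single_eq_of_ne ?_
    rintro rfl
    exact hX (isInsertionFin_insertFin h i T S f)

theorem weightedComp_left_apply (x : RT K n) (y : RT K m) (X : RTree (Fin k)) :
    weightedComp K lam h i γ x y X =
      ∑ T, x T * weightedComp K lam h i γ (Finsupp.single T 1) y X := by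
  conv_lhs => rw [← Finsupp.univ_sum_single x]
  simp only [map_sum, LinearMap.sum_apply, Finsupp.finsetSum_apply]
  refine Finset.sum_congr rfl fun T _ => ?_
  rw [← mul_one (x T), ← smul_eq_mul, ← Finsupp.smul_single, map_smul]
  simp

theorem weightedComp_right_apply (x : RT K n) (y : RT K m) (X : RTree (Fin k)) :
    weightedComp K lam h i γ x y X =
      ∑ S, y S * weightedComp K lam h i γ x (Finsupp.single S 1) X := by
  conv_lhs => rw [← Finsupp.univ_sum_single y]
  simp only [map_sum, Finsupp.finsetSum_apply]
  refine Finset.sum_congr rfl fun S _ => ?_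
  rw [← mul_one (y S), ← smul_eq_mul, ← Finsupp.smul_single, map_smul]
  simp

end WeightedComp

/-! ## Associativity -/

/-- The energy `y` of the intermediate tree cancels, as both inequalities make the natural
subtractions exact. -/
theorem weight_eq_of_sub_add {R : Type*} [Monoid R] (lam : R) {x y t s u : ℕ} (h1 : t + s ≤ y)
    (h2 : y + u ≤ x) : lam ^ (y - (t + s)) * lam ^ (x - (y + u)) = lam ^ (x - (t + s + u)) := by
  rw [← pow_add]
  congr 1
  omega

/-! ### Nested associativity -/

section Nested

variable {n m l p q r : ℕ} (hp : n + m = p + 1) (hr : p + l = r + 1)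
  (hq : m + l = q + 1) (hr' : n + q = r + 1) (i : Fin n) (j : Fin m)

theorem slotProj_slotEmb_nested (z : Fin q) :
    slotProj hr (slotEmb hp i j) (slotEmb hr' i z) = slotEmb hp i (slotProj hq j z) := by
  ext
  have h1 := slotProj_val hr (slotEmb hp i j) (slotEmb hr' i z)
  have h2 := slotProj_val hq j z
  simp only [slotEmb_val] at *
  omega

theorem slotEmb_slotEmb_nested (u : Fin l) :
    slotEmb hr' i (slotEmb hq j u) = slotEmb hr (slotEmb hp i j) u := by
  ext
  simp only [slotEmb_val]
  omega

theorem slotProj_comp_slotProj_nested :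
    slotProj hp i ∘ slotProj hr (slotEmb hp i j) = slotProj hr' i := by
  funext c
  ext
  have h1 := slotProj_val hp i (slotProj hr (slotEmb hp i j) c)
  have h2 := slotProj_val hr (slotEmb hp i j) c
  have h3 := slotProj_val hr' i c
  simp only [slotEmb_val, Function.comp_apply] at *
  omega

open RTree

theorem exists_nested_iff (T : RTree (Fin n)) (S : RTree (Fin m)) (U : RTree (Fin l))
    (X : RTree (Fin r)) :
    (∃ Y, IsInsertionFin hp i T S Y ∧ IsInsertionFin hr (slotEmb hp i j) Y U X) ↔
      ∃ Z, IsInsertionFin hq j S U Z ∧ IsInsertionFin hr' i T Z X := by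
  have hpp := slotProj_comp_slotProj_nested hp hr hr' i j
  have hpq := slotProj_slotEmb_nested hp hr hq hr' i j
  have hqq := slotEmb_slotEmb_nested hp hr hq hr' i j
  have c₁ := isCollapse_slot hr (slotEmb hp i j)
  have c₂ := isCollapse_slot hp i
  have c₂' := isCollapse_slot hq j
  have c₁' := isCollapse_slot hr' i
  constructor
  · rintro ⟨Y, hY, hX⟩
    -- The attachments needed to build `Z` are read off from `X`: the parent of a vertex over a
    -- child of `j` lies in the block of `U`.
    have H : ∀ b : Fin m, ∃ u : Fin l, ∀ z, slotProj hq j z = b → b ≠ j → S.parent b = j →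
        X.parent (slotEmb hr' i z) = slotEmb hr (slotEmb hp i j) u := by
      intro b
      by_cases hb : b ≠ j ∧ S.parent b = j
      · obtain ⟨hbj, hpb⟩ := hb
        obtain ⟨z, rfl⟩ := c₂'.proj_surj b hbj
        have hne : slotEmb hp i (slotProj hq j z) ≠ slotEmb hp i j := c₂.emb_injective.ne hbj
        have hbr : slotProj hq j z ≠ S.root := fun h' =>
          hbj ((S.parent_eq_self_iff.2 h').symm.trans hpb)
        obtain ⟨u, hu⟩ := c₁.exists_emb (X.parent (slotEmb hr' i z)) (by
          rw [hX.outer _ (by rwa [hpq]), hpq, hY.inner _ hbr, hpb])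
        refine ⟨u, fun z' hz' _ _ => ?_⟩
        rw [hu, c₂'.proj_inj z' z hz' (by rwa [hz'])]
      · exact ⟨U.root, fun z _ h1 h2 => absurd ⟨h1, h2⟩ hb⟩
    choose F hF using H
    obtain ⟨Z, hZ, hZF⟩ := exists_insertionFin hq j S U F
    refine ⟨Z, hZ, ?_⟩
    have := IsInsertion.nested c₁ c₂ c₂' rfl hpq hqq hY hX hZ
      fun z h1 h2 => by rw [hZF z h1 h2, hqq, hF _ z rfl h1 h2]
    rwa [hpp] at this
  · rintro ⟨Z, hZ, hX⟩
    -- Conversely, the attachments defining `Y` are those of `X` after the block of `U` is collapsed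
    -- to `j`.
    have H : ∀ a : Fin n, ∃ b : Fin m, ∀ c, slotProj hr' i c = a → a ≠ i → T.parent a = i →
        slotProj hr (slotEmb hp i j) (X.parent c) = slotEmb hp i b := by
      intro a
      by_cases ha : a ≠ i ∧ T.parent a = i
      · obtain ⟨hai, hpa⟩ := ha
        obtain ⟨c, rfl⟩ := c₁'.proj_surj a hai
        obtain ⟨z, hz⟩ := c₁'.exists_emb (X.parent c) (by rw [hX.outer c hai, hpa])
        refine ⟨slotProj hq j z, fun c' hc' _ _ => ?_⟩
        rw [c₁'.proj_inj c' c hc' (by rwa [hc']), ← hz, hpq]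
      · exact ⟨S.root, fun c _ h1 h2 => absurd ⟨h1, h2⟩ ha⟩
    choose F hF using H
    obtain ⟨Y, hY, hYF⟩ := exists_insertionFin hp i T S F
    rw [← hpp] at c₁' hF
    rw [IsInsertionFin, ← hpp] at hX
    refine ⟨Y, hY, IsInsertion.nested_symm c₁' c₂ c₂' rfl hpq hqq hZ hX hY fun c h1 h2 => ?_⟩
    have h3 : slotProj hr (slotEmb hp i j) c ≠ slotEmb hp i j := fun h' => h1 (by
      rw [h', c₂.proj_emb])
    rw [hF _ c rfl h1 h2, hYF _ h1 h2]
    rfl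

variable (γ : Fin r → ℕ+)

theorem innerWeight_innerWeight_nested :
    innerWeight hq j (innerWeight hr' i γ) = innerWeight hr (slotEmb hp i j) γ :=
  funext fun u => congrArg γ (slotEmb_slotEmb_nested hp hr hq hr' i j u)

theorem innerWeight_outerWeight_nested (hl : l ≠ 0) :
    innerWeight hp i (outerWeight hr (slotEmb hp i j) γ) =
      outerWeight hq j (innerWeight hr' i γ) := by
  funext b
  change outerWeight hr (slotEmb hp i j) γ (slotEmb hp i b) = _
  by_cases hb : b = j
  · subst hb
    apply PNat.eq
    rw [outerWeight_self _ _ _ hl, outerWeight_self _ _ _ hl,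
      innerWeight_innerWeight_nested hp hr hq hr' i b]
  · obtain ⟨z, rfl⟩ := (isCollapse_slot hq j).proj_surj b hb
    rw [outerWeight_slotProj _ _ _ hb, ← slotProj_slotEmb_nested hp hr hq hr' i j,
      outerWeight_slotProj]
    · rfl
    · rw [slotProj_slotEmb_nested hp hr hq hr' i j]
      exact (isCollapse_slot hp i).emb_injective.ne hb

/-- At `i`, both sides are total weights of a block. Replacing the vertices of `U` by the single
vertex `j` of weight `|U|` does not change the total. -/
theorem outerWeight_outerWeight_nested (hl : l ≠ 0) :
    outerWeight hp i (outerWeight hr (slotEmb hp i j) γ) = outerWeight hr' i γ := by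
  funext a
  by_cases ha : a = i
  · subst ha
    apply PNat.eq
    have hm : m ≠ 0 := by
      rintro rfl
      exact j.elim0
    obtain ⟨q', hq⟩ : ∃ q', m + l = q' + 1 := ⟨m + l - 1, by omega⟩
    obtain rfl : q' = q := by omega
    rw [outerWeight_self _ _ _ hm, outerWeight_self _ _ _ (by omega),
      innerWeight_outerWeight_nested hp hr hq hr' a j γ hl, sum_slot hq j,
      sum_eq_add_sum_ne j, outerWeight_self _ _ _ hl, add_comm]
    congr 1
    exact Finset.sum_congr rfl fun b _ => by rw [outerWeight_ne _ _ _ b.2]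
  · obtain ⟨c, rfl⟩ := (isCollapse_slot hr' i).proj_surj a ha
    rw [outerWeight_slotProj _ _ _ ha]
    rw [← slotProj_comp_slotProj_nested hp hr hr' i j, Function.comp_apply] at ha ⊢
    rw [outerWeight_slotProj _ _ _ ha, outerWeight_slotProj]
    intro h'
    exact ha (by rw [h', slotProj_slotEmb])

variable {K : Type u} [Field K] (lam : K)

theorem weightedComp_nested (x : RT K n) (y : RT K m) (z : RT K l) :
    weightedComp K lam hr (slotEmb hp i j) γ
        (weightedComp K lam hp i (outerWeight hr (slotEmb hp i j) γ) x y) z =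
      weightedComp K lam hr' i γ x (weightedComp K lam hq j (innerWeight hr' i γ) y z) := by
  classical
  induction x using Finsupp.induction_linear with
  | zero => simp
  | add x x' hx hx' => simp [hx, hx']
  | single T s =>
  induction y using Finsupp.induction_linear with
  | zero => simp
  | add y y' hy hy' => simp [hy, hy']
  | single S t =>
  induction z using Finsupp.induction_linear with
  | zero => simp
  | add z z' hz hz' => simp [hz, hz']
  | single U w =>
  rw [← mul_one s, ← mul_one t, ← mul_one w]
  simp only [← smul_eq_mul, ← Finsupp.smul_single, map_smul, LinearMap.smul_apply]
  have hl : l ≠ 0 := by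
    rintro rfl
    exact U.root.elim0
  congr 3
  ext X
  -- The left side is expanded over `Y`, a contraction of `X`, and the right side over `Z`, the
  -- restriction of `X` to a block. Both sums reduce to the same power `W` of `lam`.
  rw [weightedComp_left_apply, weightedComp_right_apply]
  simp only [weightedComp_single_single_apply]
  have hw := innerWeight_innerWeight_nested hp hr hq hr' i j γ
  have hw' := innerWeight_outerWeight_nested hp hr hq hr' i j γ hl
  have hw'' := outerWeight_outerWeight_nested hp hr hr' i j γ hl
  rw [sum_ite_mul_ite (W := lam ^ (X.energy γ - (T.energy (outerWeight hr' i γ) +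
      S.energy (outerWeight hq j (innerWeight hr' i γ)) +
      U.energy (innerWeight hr (slotEmb hp i j) γ))))
      (fun Y Y' hY hY' => hY.outer_unique hY' (isCollapse_slot _ _)) fun Y hY hX => ?_,
    sum_ite_mul_ite (W := lam ^ (X.energy γ - (T.energy (outerWeight hr' i γ) +
      S.energy (outerWeight hq j (innerWeight hr' i γ)) +
      U.energy (innerWeight hr (slotEmb hp i j) γ))))
      (fun Z Z' hZ hZ' => hZ.inner_unique hZ' (isCollapse_slot _ _)) fun Z hZ hX => ?_]
  · simp only [exists_nested_iff hp hr hq hr' i j]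
  · have h1 := hZ.energy_ge hq j (innerWeight hr' i γ)
    have h2 := hX.energy_ge hr' i γ
    rw [hw] at h1 ⊢
    rw [add_comm (T.energy _)] at h2 ⊢
    rw [weight_eq_of_sub_add lam h1 h2]
    congr 2
    ring
  · have h1 := hY.energy_ge hp i (outerWeight hr (slotEmb hp i j) γ)
    have h2 := hX.energy_ge hr (slotEmb hp i j) γ
    rw [hw', hw''] at h1 ⊢
    exact weight_eq_of_sub_add lam h1 h2

end Nested

/-! ### Disjoint associativity -/

section Disjoint

variable {n m l p q r : ℕ} (hp : n + m = p + 1) (hr : p + l = r + 1)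
  (hq : n + l = q + 1) (hr' : q + m = r + 1) {i j : Fin n} {v : Fin p} {v' : Fin q}
  (hv : slotProj hp i v = j) (hv' : slotProj hq j v' = i)

include hv hv' in
-- The positions `v` and `v'` are described only by their collapses, with no order on `i` and `j`.
-- The setting is then symmetric, and each lemma can be reused with the two insertions exchanged.
theorem slotProj_slotProj_disjoint (c : Fin r) :
    slotProj hp i (slotProj hr v c) = slotProj hq j (slotProj hr' v' c) := by
  ext
  have h1 := slotProj_val hp i v
  have h2 := slotProj_val hq j v'
  have h3 := slotProj_val hp i (slotProj hr v c)
  have h4 := slotProj_val hr v c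
  have h5 := slotProj_val hq j (slotProj hr' v' c)
  have h6 := slotProj_val hr' v' c
  rw [hv] at h1
  rw [hv'] at h2
  omega

include hv hv' in
theorem slotProj_slotEmb_disjoint (hij : i ≠ j) (b : Fin m) :
    slotProj hr v (slotEmb hr' v' b) = slotEmb hp i b := by
  ext
  have h1 := slotProj_val hp i v
  have h2 := slotProj_val hq j v'
  have h3 := slotProj_val hr v (slotEmb hr' v' b)
  rw [hv] at h1
  rw [hv'] at h2
  rw [Ne, Fin.ext_iff] at hij
  simp only [slotEmb_val] at *
  omega

open RTree

include hv hv' in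
theorem exists_disjoint (hij : i ≠ j) {T : RTree (Fin n)} {S : RTree (Fin m)} {U : RTree (Fin l)}
    {X : RTree (Fin r)} (hex : ∃ Y, IsInsertionFin hp i T S Y ∧ IsInsertionFin hr v Y U X) :
    ∃ Y, IsInsertionFin hq j T U Y ∧ IsInsertionFin hr' v' Y S X := by
  have hpp := slotProj_slotProj_disjoint hp hr hq hr' hv hv'
  have hpq := slotProj_slotEmb_disjoint hp hr hq hr' hv hv' hij
  have hpq' := slotProj_slotEmb_disjoint hq hr' hp hr hv' hv hij.symm
  have c₁ := isCollapse_slot hr v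
  have c₂ := isCollapse_slot hp i
  have c₁' := isCollapse_slot hr' v'
  have c₂' := isCollapse_slot hq j
  obtain ⟨Y, hY, hX⟩ := hex
  have H : ∀ a : Fin n, ∃ u : Fin l, ∀ c, slotProj hp i (slotProj hr v c) = a → a ≠ j →
      (a = i → c = slotEmb hr' v' S.root) → T.parent a = j → X.parent c = slotEmb hr v u := by
    intro a
    by_cases hex : ∃ c, slotProj hp i (slotProj hr v c) = a ∧ a ≠ j ∧
      (a = i → c = slotEmb hr' v' S.root) ∧ T.parent a = j
    · obtain ⟨c, rfl, haj, hai, hpa⟩ := hex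
      have hcv : slotProj hr v c ≠ v := fun h' => haj (by rw [h', hv])
      -- If the child of `j` under consideration is `i` itself, it is represented by the root of
      -- `S`, whose parent in `Y` is governed by `base` and not by `outer`.
      have h1 : slotProj hp i (Y.parent (slotProj hr v c)) = j := by
        by_cases hi : slotProj hp i (slotProj hr v c) = i
        · rw [hai hi, hpq, hY.base, ← hi, hpa]
        · rw [hY.outer _ hi, hpa]
      obtain ⟨u, hu⟩ := c₁.exists_emb (X.parent c) (by
        rw [hX.outer c hcv]
        exact c₂.proj_inj _ _ (by rw [h1, hv]) (by rw [h1]; exact hij.symm))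
      refine ⟨u, fun c' hc' _ hai' _ => ?_⟩
      have hcc : c' = c := by
        by_cases hi : slotProj hp i (slotProj hr v c) = i
        · rw [hai hi, hai' hi]
        · refine c₁.proj_inj _ _ (c₂.proj_inj _ _ hc' (by rwa [hc'])) fun h' => haj ?_
          rw [← hc', h', hv]
      rw [hcc, hu]
    · exact ⟨U.root, fun c h1 h2 h3 h4 => absurd ⟨c, h1, h2, h3, h4⟩ hex⟩
  choose F hF using H
  obtain ⟨Y', hY', hYF⟩ := exists_insertionFin hq j T U F
  refine ⟨Y', hY', IsInsertion.disjoint c₁ c₂ c₁' c₂' hij hv hv' hpp hpq hpq' hY hX hY'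
    fun c h1 h2 h3 => ?_⟩
  rw [hF _ c rfl h1 h2 h3, hpq', hpp c, hYF _ (by rwa [← hpp]) (by rwa [← hpp])]

variable (γ : Fin r → ℕ+)

include hq hv hv' in
theorem innerWeight_outerWeight_disjoint (hij : i ≠ j) :
    innerWeight hp i (outerWeight hr v γ) = innerWeight hr' v' γ := by
  funext b
  change outerWeight hr v γ (slotEmb hp i b) = _
  have h1 := slotProj_slotEmb_disjoint hp hr hq hr' hv hv' hij b
  rw [← h1, outerWeight_slotProj]
  · rfl
  · rw [h1]
    rintro h2
    exact hij (by rw [← hv, ← h2, slotProj_slotEmb])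

include hv hv' in
theorem outerWeight_outerWeight_disjoint (hij : i ≠ j) (hm : m ≠ 0) (hl : l ≠ 0) :
    outerWeight hp i (outerWeight hr v γ) = outerWeight hq j (outerWeight hr' v' γ) := by
  -- All arities are quantified afresh so that the same computation, with the insertions exchanged,
  -- gives the value at `j`.
  have key : ∀ {m l p q : ℕ} (hp : n + m = p + 1) (hr : p + l = r + 1) (hq : n + l = q + 1)
      (hr' : q + m = r + 1) {i j : Fin n} {v : Fin p} {v' : Fin q}
      (_ : slotProj hp i v = j) (_ : slotProj hq j v' = i) (_ : i ≠ j) (_ : m ≠ 0),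
      outerWeight hp i (outerWeight hr v γ) i = outerWeight hq j (outerWeight hr' v' γ) i := by
    intro m l p q hp hr hq hr' i j v v' hv hv' hij hm
    apply PNat.eq
    rw [outerWeight_self _ _ _ hm, innerWeight_outerWeight_disjoint hp hr hq hr' hv hv' _ hij,
      ← outerWeight_self _ _ _ hm]
    subst hv'
    rw [outerWeight_slotProj _ _ _ hij]
  funext a
  by_cases hai : a = i
  · subst hai
    exact key hp hr hq hr' hv hv' hij hm
  by_cases haj : a = j
  · subst haj
    exact (key hq hr' hp hr hv' hv hij.symm hl).symm
  obtain ⟨d, rfl⟩ := (isCollapse_slot hp i).proj_surj a hai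
  obtain ⟨c, rfl⟩ := (isCollapse_slot hr v).proj_surj d fun h' => haj (by rw [h', hv])
  have hpp := slotProj_slotProj_disjoint hp hr hq hr' hv hv' c
  rw [outerWeight_slotProj _ _ _ hai, outerWeight_slotProj _ _ _ fun h' => haj (by rw [h', hv])]
  rw [hpp] at hai haj ⊢
  rw [outerWeight_slotProj _ _ _ haj, outerWeight_slotProj _ _ _ fun h' => hai (by rw [h', hv'])]

variable {K : Type u} [Field K] (lam : K)

include hv hv' in
theorem weightedComp_disjoint (hij : i ≠ j) (x : RT K n) (y : RT K m) (z : RT K l) :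
    weightedComp K lam hr v γ (weightedComp K lam hp i (outerWeight hr v γ) x y) z =
      weightedComp K lam hr' v' γ (weightedComp K lam hq j (outerWeight hr' v' γ) x z) y := by
  classical
  induction x using Finsupp.induction_linear with
  | zero => simp
  | add x x' hx hx' => simp [hx, hx']
  | single T s =>
  induction y using Finsupp.induction_linear with
  | zero => simp
  | add y y' hy hy' => simp [hy, hy']
  | single S t =>
  induction z using Finsupp.induction_linear with
  | zero => simp
  | add z z' hz hz' => simp [hz, hz']
  | single U w =>
  rw [← mul_one s, ← mul_one t, ← mul_one w]
  simp only [← smul_eq_mul, ← Finsupp.smul_single, map_smul, LinearMap.smul_apply]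
  rw [smul_comm t w]
  have hm : m ≠ 0 := by
    rintro rfl
    exact S.root.elim0
  have hl : l ≠ 0 := by
    rintro rfl
    exact U.root.elim0
  congr 3
  ext X
  rw [weightedComp_left_apply, weightedComp_left_apply _ hr']
  simp only [weightedComp_single_single_apply]
  have hw := innerWeight_outerWeight_disjoint hp hr hq hr' hv hv' γ hij
  have hw' := innerWeight_outerWeight_disjoint hq hr' hp hr hv' hv γ hij.symm
  have hw'' := outerWeight_outerWeight_disjoint hp hr hq hr' hv hv' γ hij hm hl
  rw [sum_ite_mul_ite (W := lam ^ (X.energy γ -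
      (T.energy (outerWeight hq j (outerWeight hr' v' γ)) + S.energy (innerWeight hr' v' γ) +
      U.energy (innerWeight hr v γ))))
      (fun Y Y' hY hY' => hY.outer_unique hY' (isCollapse_slot _ _)) fun Y hY hX => ?_,
    sum_ite_mul_ite (W := lam ^ (X.energy γ -
      (T.energy (outerWeight hq j (outerWeight hr' v' γ)) + S.energy (innerWeight hr' v' γ) +
      U.energy (innerWeight hr v γ))))
      (fun Y Y' hY hY' => hY.outer_unique hY' (isCollapse_slot _ _)) fun Y hY hX => ?_]
  · congr 1
    exact propext ⟨exists_disjoint hp hr hq hr' hv hv' hij,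
      exists_disjoint hq hr' hp hr hv' hv hij.symm⟩
  · have h1 := hY.energy_ge hq j (outerWeight hr' v' γ)
    have h2 := hX.energy_ge hr' v' γ
    rw [hw'] at h1 ⊢
    rw [weight_eq_of_sub_add lam h1 h2]
    congr 2
    ring
  · have h1 := hY.energy_ge hp i (outerWeight hr v γ)
    have h2 := hX.energy_ge hr v γ
    rw [hw, hw''] at h1 ⊢
    exact weight_eq_of_sub_add lam h1 h2

end Disjoint

open RTree

/-! ## Units -/

theorem slotEmb_zero {n : ℕ} (h : 1 + n = n + 1) (b : Fin n) : slotEmb h 0 b = b := by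
  ext
  simp [slotEmb_val]

theorem slotProj_rfl {n : ℕ} (i c : Fin n) : slotProj (rfl : n + 1 = n + 1) i c = c := by
  ext
  have := slotProj_val (rfl : n + 1 = n + 1) i c
  omega

theorem slotEmb_rfl {n : ℕ} (i : Fin n) (b : Fin 1) : slotEmb (rfl : n + 1 = n + 1) i b = i := by
  ext
  simp [slotEmb_val]

theorem isInsertionFin_single_left {n : ℕ} (h : 1 + n = n + 1) (S : RTree (Fin n)) :
    IsInsertionFin h 0 RTree.single S S where
  outer _ hc := absurd (Subsingleton.elim _ _) hc
  inner b _ := by rw [slotEmb_zero, slotEmb_zero]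
  base := Subsingleton.elim _ _
  base_of_root _ := by rw [slotEmb_zero, S.parent_root]

theorem isInsertionFin_single_right {n : ℕ} (i : Fin n) (T : RTree (Fin n)) :
    IsInsertionFin rfl i T RTree.single T where
  outer c _ := by rw [slotProj_rfl, slotProj_rfl]
  inner b hb := absurd (Subsingleton.elim _ _) hb
  base := by rw [slotProj_rfl, slotEmb_rfl]
  base_of_root hi := by rwa [slotEmb_rfl]

section Units

variable {K : Type u} [Field K] (lam : K) {n : ℕ}

theorem weightedComp_single_left (h : 1 + n = n + 1) (γ : Fin n → ℕ+) (x : RT K n) :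
    weightedComp K lam h 0 γ (Finsupp.single RTree.single 1) x = x := by
  induction x using Finsupp.induction_linear with
  | zero => simp
  | add x x' hx hx' => simp [hx, hx']
  | single S s =>
  rw [← mul_one s, ← smul_eq_mul, ← Finsupp.smul_single, map_smul, weightedComp_single_single]
  have : IsEmpty (RTree.single.Edges 0) := ⟨fun e => e.2.2 (Subsingleton.elim _ _)⟩
  -- No edge arrives at the single vertex, so there is one map `f`, equal to the constant one, with
  -- exponent `0`.
  rw [Fintype.sum_subsingleton _ fun _ => S.root, energy_insertFin_root, Nat.sub_self, pow_zero,
    (isInsertionFin_insertFin h 0 RTree.single S _).eq_of_parent_eq (isInsertionFin_single_left h S)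
      (isCollapse_slot h 0) fun c hc => absurd (Subsingleton.elim _ _) hc]

theorem weightedComp_single_right (i : Fin n) (γ : Fin n → ℕ+) (x : RT K n) :
    weightedComp K lam rfl i γ x (Finsupp.single RTree.single 1) = x := by
  induction x using Finsupp.induction_linear with
  | zero => simp
  | add x x' hx hx' => simp [hx, hx']
  | single T s =>
  rw [← mul_one s, ← smul_eq_mul, ← Finsupp.smul_single, map_smul, LinearMap.smul_apply,
    weightedComp_single_single, Fintype.sum_subsingleton _ fun _ => RTree.single.root,
    energy_insertFin_root, Nat.sub_self, pow_zero,
    (isInsertionFin_insertFin rfl i T RTree.single _).eq_of_parent_eq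
      (isInsertionFin_single_right i T) (isCollapse_slot rfl i) fun c hc hp => ?_]
  rw [insertFin_parent_of_edge rfl i _ c hc hp, slotEmb_rfl, ← hp, slotProj_rfl]

theorem innerWeight_zero (h : 1 + n = n + 1) (γ : Fin n → ℕ+) : innerWeight h 0 γ = γ :=
  funext fun b => congrArg γ (slotEmb_zero h b)

theorem outerWeight_rfl (i : Fin n) (γ : Fin n → ℕ+) :
    outerWeight (rfl : n + 1 = n + 1) i γ = γ := by
  funext a
  by_cases ha : a = i
  · subst ha
    apply PNat.eq
    rw [outerWeight_self _ _ _ one_ne_zero, Fin.sum_univ_one]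
    exact congrArg (fun a => (γ a : ℕ)) (slotEmb_rfl a 0)
  · conv_lhs => rw [← slotProj_rfl i a]
    exact outerWeight_slotProj _ _ _ (by rwa [slotProj_rfl])

end Units

/-! ## Equivariance -/

section Equivariance

theorem perm_inv_apply_self {α : Type*} (σ : Perm α) (a : α) : σ⁻¹ (σ a) = a :=
  σ.symm_apply_apply a

theorem perm_apply_inv_self {α : Type*} (σ : Perm α) (a : α) : σ (σ⁻¹ a) = a :=
  σ.apply_symm_apply a

variable {n m k : ℕ} (h : n + m = k + 1) (i : Fin n) (σ : Perm (Fin n)) (τ : Perm (Fin m))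

theorem blockPerm_slotEmb (b : Fin m) :
    blockPerm h i σ τ (slotEmb h i b) = slotEmb h (σ i) (τ b) := by
  simp [blockPerm, slotEmb]

theorem slotProj_blockPerm (c : Fin k) :
    slotProj h (σ i) (blockPerm h i σ τ c) = σ (slotProj h i c) := by
  obtain ⟨a | b, rfl⟩ := (slot h i).surjective c
  · simp [blockPerm, subtypeEquiv]
  · rw [← slotEmb, blockPerm_slotEmb, slotProj_slotEmb, slotProj_slotEmb]

/-- The block permutation intertwines the collapses and the embeddings at `i` and at `σ i`, so this
is the invariance of insertions under bijections, applied in both directions. -/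
theorem isInsertionFin_relabel_iff (T : RTree (Fin n)) (S : RTree (Fin m)) (X : RTree (Fin k)) :
    IsInsertionFin h i (T.relabel σ⁻¹) (S.relabel τ⁻¹) X ↔
      IsInsertionFin h (σ i) T S (X.relabel (blockPerm h i σ τ)) := by
  have relabel_inv : ∀ {l : ℕ} (σ : Perm (Fin l)) (T : RTree (Fin l)),
      (T.relabel σ).relabel σ⁻¹ = T := fun σ T => by
    rw [relabel_relabel, Perm.inv_def, self_trans_symm, relabel_refl]
  refine ⟨fun hX => ?_, fun hX => ?_⟩
  · refine IsInsertion.of_relabel σ⁻¹ τ⁻¹ (blockPerm h i σ τ)⁻¹ (perm_inv_apply_self σ i)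
      (fun c => ?_) (fun b => ?_) (by rwa [relabel_inv])
    · rw [Perm.inv_eq_iff_eq, ← slotProj_blockPerm h i σ τ, perm_apply_inv_self]
    · rw [Perm.inv_eq_iff_eq, blockPerm_slotEmb, perm_apply_inv_self]
  · refine IsInsertion.of_relabel σ τ (blockPerm h i σ τ) rfl
      (fun c => (slotProj_blockPerm h i σ τ c).symm) (blockPerm_slotEmb h i σ τ) ?_
    have h1 := relabel_inv σ⁻¹ T
    have h2 := relabel_inv τ⁻¹ S
    rw [inv_inv] at h1 h2
    rwa [h1, h2]

theorem innerWeight_blockPerm (γ : Fin k → ℕ+) :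
    innerWeight h (σ i) (fun c => γ ((blockPerm h i σ τ)⁻¹ c)) =
      fun b => innerWeight h i γ (τ⁻¹ b) := by
  funext b
  refine congrArg γ ?_
  change _ = slotEmb h i (τ⁻¹ b)
  rw [Perm.inv_eq_iff_eq, blockPerm_slotEmb, perm_apply_inv_self]
  rfl

theorem outerWeight_blockPerm (hm : m ≠ 0) (γ : Fin k → ℕ+) :
    outerWeight h (σ i) (fun c => γ ((blockPerm h i σ τ)⁻¹ c)) =
      fun a => outerWeight h i γ (σ⁻¹ a) := by
  funext a
  obtain ⟨a, rfl⟩ := σ.surjective a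
  rw [perm_inv_apply_self]
  by_cases ha : a = i
  · subst ha
    apply PNat.eq
    rw [outerWeight_self _ _ _ hm, outerWeight_self _ _ _ hm, innerWeight_blockPerm]
    exact Equiv.sum_comp τ⁻¹ fun b => (innerWeight h a γ b : ℕ)
  · obtain ⟨c, rfl⟩ := (isCollapse_slot h i).proj_surj a ha
    rw [outerWeight_slotProj _ _ _ ha, ← slotProj_blockPerm h i σ τ, outerWeight_slotProj]
    · rw [perm_inv_apply_self]
    · rwa [slotProj_blockPerm, σ.injective.ne_iff]

variable {K : Type u} [Field K] (lam : K)

theorem relabelRT_single (T : RTree (Fin n)) (s : K) :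
    relabelRT K σ (Finsupp.single T s) = Finsupp.single (T.relabel σ⁻¹) s :=
  Finsupp.mapDomain_single

theorem relabel_injective (σ : Perm (Fin n)) : Function.Injective (relabel σ) := by
  intro T S hTS
  rw [← (relabel_symm_eq_iff σ T _).2 rfl, hTS, (relabel_symm_eq_iff σ S _).2 rfl]

theorem relabelRT_apply (x : RT K n) (X : RTree (Fin n)) :
    relabelRT K σ x X = x (X.relabel σ) := by
  have hX := (relabel_symm_eq_iff σ X _).2 rfl
  conv_lhs => rw [← hX]
  exact Finsupp.mapDomain_apply (relabel_injective σ⁻¹) x _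

theorem weightedComp_relabelRT (γ : Fin k → ℕ+) (x : RT K n) (y : RT K m) :
    weightedComp K lam h i γ (relabelRT K σ x) (relabelRT K τ y) =
      relabelRT K (blockPerm h i σ τ)
        (weightedComp K lam h (σ i) (fun c => γ ((blockPerm h i σ τ)⁻¹ c)) x y) := by
  classical
  induction x using Finsupp.induction_linear with
  | zero => simp
  | add x x' hx hx' => simp [hx, hx']
  | single T s =>
  induction y using Finsupp.induction_linear with
  | zero => simp
  | add y y' hy hy' => simp [hy, hy']
  | single S t =>
  rw [← mul_one s, ← mul_one t]
  simp only [← smul_eq_mul, ← Finsupp.smul_single, map_smul, LinearMap.smul_apply]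
  congr 2
  have hm : m ≠ 0 := by
    rintro rfl
    exact S.root.elim0
  ext X
  simp only [relabelRT_single, relabelRT_apply, weightedComp_single_single_apply,
    isInsertionFin_relabel_iff, energy_relabel, innerWeight_blockPerm,
    outerWeight_blockPerm h i σ τ hm, perm_inv_apply_self]

end Equivariance

/-! ## The operads and their morphisms -/

section Operad

variable {K : Type u} [Field K] (lam : K)

theorem weightedOperad_act_apply {n : ℕ} (σ : Perm (Fin n)) (x : WRT K n) (μ : Fin n → ℕ+) :
    (weightedOperad K lam).act σ x μ = relabelRT K σ (x fun v => μ (σ⁻¹ v)) := rfl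

theorem weightedOperad_comp_apply {n m k : ℕ} (h : n + m = k + 1) (i : Fin n) (x : WRT K n)
    (y : WRT K m) (γ : Fin k → ℕ+) : (weightedOperad K lam).comp h i x y γ =
      weightedComp K lam h i γ (x (outerWeight h i γ)) (y (innerWeight h i γ)) := rfl

theorem relabelRT_one {n : ℕ} (x : RT K n) : relabelRT K 1 x = x := by
  ext X
  rw [relabelRT_apply]
  rfl

theorem relabelRT_mul {n : ℕ} (σ τ : Perm (Fin n)) (x : RT K n) :
    relabelRT K (σ * τ) x = relabelRT K τ (relabelRT K σ x) := by
  ext X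
  rw [relabelRT_apply, relabelRT_apply, relabelRT_apply]
  rfl

/-- There is no rooted tree without vertices. This settles compositions with an arity zero
operation, where the identities between outer weights are not available. -/
theorem WRT.eq_zero {n : ℕ} (hn : n = 0) (x : WRT K n) : x = 0 := by
  subst hn
  exact funext fun μ => Subsingleton.elim _ _

/-- The weighted rooted trees form an operad, for every value of the parameter. -/
theorem weightedOperad_isOperad : (weightedOperad K lam).IsOperad where
  act_one x := funext fun μ => relabelRT_one _
  act_mul σ τ x := funext fun μ => relabelRT_mul σ τ _
  assoc_nested {n m l p q r} hp hr hq hr' i j a b c := by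
    by_cases hl : l = 0
    · rw [show c = 0 from WRT.eq_zero hl c]
      simp
    funext γ
    change weightedComp K lam hr (slotEmb hp i j) γ (weightedComp K lam hp i
        (outerWeight hr (slotEmb hp i j) γ)
        (a (outerWeight hp i (outerWeight hr (slotEmb hp i j) γ)))
        (b (innerWeight hp i (outerWeight hr (slotEmb hp i j) γ))))
        (c (innerWeight hr (slotEmb hp i j) γ)) =
      weightedComp K lam hr' i γ (a _) (weightedComp K lam hq j _ (b _) (c _))
    rw [weightedComp_nested hp hr hq hr',
      outerWeight_outerWeight_nested hp hr hr' i j γ hl,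
      innerWeight_outerWeight_nested hp hr hq hr' i j γ hl,
      innerWeight_innerWeight_nested hp hr hq hr' i j γ]
  assoc_disjoint {n m l p q r} hp hr hq hr' i j hij a b c := by
    by_cases hl : l = 0
    · rw [show c = 0 from WRT.eq_zero hl c]
      simp
    by_cases hm : m = 0
    · rw [show b = 0 from WRT.eq_zero hm b]
      simp
    funext γ
    have hv := slotProj_slot_inl hp i ⟨j, hij.ne'⟩
    have hv' := slotProj_slot_inl hq j ⟨i, hij.ne⟩
    change weightedComp K lam hr _ γ (weightedComp K lam hp i _ (a _) (b _)) (c _) =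
      weightedComp K lam hr' _ γ (weightedComp K lam hq j _ (a _) (c _)) (b _)
    rw [weightedComp_disjoint hp hr hq hr' hv hv' γ lam hij.ne,
      outerWeight_outerWeight_disjoint hp hr hq hr' hv hv' γ hij.ne hm hl,
      innerWeight_outerWeight_disjoint hp hr hq hr' hv hv' γ hij.ne,
      innerWeight_outerWeight_disjoint hq hr' hp hr hv' hv γ hij.ne']
  one_comp {n} h a := by
    funext γ
    change weightedComp K lam h 0 γ (Finsupp.single RTree.single 1) (a _) = a γ
    rw [innerWeight_zero, weightedComp_single_left]
  comp_one {n} i a := by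
    funext γ
    change weightedComp K lam rfl i γ (a _) (Finsupp.single RTree.single 1) = a γ
    rw [outerWeight_rfl, weightedComp_single_right]
  equivariance {n m k} h i σ τ a b := by
    by_cases hm : m = 0
    · rw [show b = 0 from WRT.eq_zero hm b]
      simp
    funext γ
    change weightedComp K lam h i γ (relabelRT K σ (a _)) (relabelRT K τ (b _)) =
      relabelRT K (blockPerm h i σ τ) (weightedComp K lam h (σ i) _ (a _) (b _))
    rw [weightedComp_relabelRT,
      innerWeight_blockPerm, outerWeight_blockPerm h i σ τ hm]

/-- Operad axioms can be checked after an injective family of maps compatible with the structure. -/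
theorem OperadData.IsOperad.of_injective {P Q : OperadData K} (hQ : Q.IsOperad)
    (a : ∀ n : ℕ, P.obj n →ₗ[K] Q.obj n) (ha : ∀ n, Function.Injective (a n))
    (map_act : ∀ {n : ℕ} (σ : Perm (Fin n)) (x : P.obj n), a n (P.act σ x) = Q.act σ (a n x))
    (map_one : a 1 P.one = Q.one)
    (map_comp : ∀ {n m k : ℕ} (h : n + m = k + 1) (i : Fin n) (x : P.obj n) (y : P.obj m),
      a k (P.comp h i x y) = Q.comp h i (a n x) (a m y)) : P.IsOperad where
  act_one x := ha _ (by rw [map_act, hQ.act_one])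
  act_mul σ τ x := ha _ (by simp only [map_act, hQ.act_mul])
  assoc_nested hp hr hq hr' i j x y z :=
    ha _ (by simp only [map_comp, hQ.assoc_nested hp hr hq hr'])
  assoc_disjoint hp hr hq hr' i j hij x y z :=
    ha _ (by simp only [map_comp, hQ.assoc_disjoint hp hr hq hr' i j hij])
  one_comp h x := ha _ (by rw [map_comp, map_one, hQ.one_comp])
  comp_one i x := ha _ (by rw [map_comp, map_one, hQ.comp_one])
  equivariance h i σ τ x y := ha _ (by simp only [map_comp, map_act, hQ.equivariance])

theorem allWeights_apply {n : ℕ} (x : RT K n) (μ : Fin n → ℕ+) : allWeights K n x μ = x := by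
  induction x using Finsupp.induction_linear with
  | zero => simp
  | add x x' hx hx' => simp [hx, hx']
  | single T s => simp [allWeights]

theorem allWeights_injective (n : ℕ) : Function.Injective (allWeights K n) := fun x y hxy => by
  rw [← allWeights_apply x 1, hxy, allWeights_apply]

theorem allWeights_relabelRT {n : ℕ} (σ : Perm (Fin n)) (x : RT K n) :
    allWeights K n (relabelRT K σ x) = (weightedOperad K lam).act σ (allWeights K n x) := by
  funext μ
  rw [weightedOperad_act_apply, allWeights_apply, allWeights_apply]

theorem allWeights_one :
    allWeights K 1 (Finsupp.single RTree.single 1) = (weightedOperad K lam).one :=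
  funext fun μ => allWeights_apply _ μ

theorem weightedComp_one {n m k : ℕ} (h : n + m = k + 1) (i : Fin n) (γ : Fin k → ℕ+) :
    weightedComp K 1 h i γ = (preLieOperad K).comp h i := by
  simp only [weightedComp, preLieOperad, one_pow]

/-- The constant map to the root contributes `0 ^ 0 = 1`; any other map has strictly larger energy,
hence a positive exponent and coefficient `0`. -/
theorem weightedComp_zero {n m k : ℕ} (h : n + m = k + 1) (i : Fin n) (γ : Fin k → ℕ+) :
    weightedComp K 0 h i γ = (napOperad K).comp h i := by
  unfold weightedComp napOperad
  congr 1
  funext T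
  congr 1
  funext S
  rw [Fintype.sum_eq_single fun _ => S.root]
  · rw [Nat.sub_self, pow_zero]
  · intro f hf
    have hlt := energy_insertFin_lt h i γ hf
    rw [← energy_insertFin_root] at hlt
    rw [zero_pow (by omega), Finsupp.single_zero]

/-- A structure of operad on the spaces of rooted trees whose compositions are those of weighted
trees, whatever the weights, maps to the operad of weighted trees. -/
theorem isOperadMorphism_allWeights
    (comp : ∀ {n m k : ℕ}, n + m = k + 1 → Fin n → RT K n →ₗ[K] RT K m →ₗ[K] RT K k)
    (hcomp : ∀ {n m k : ℕ} (h : n + m = k + 1) (i : Fin n) (γ : Fin k → ℕ+),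
      weightedComp K lam h i γ = comp h i) :
    IsOperadMorphism ⟨RT K, relabelRT K, Finsupp.single RTree.single 1, comp⟩
      (weightedOperad K lam) (allWeights K) := by
  have map_comp : ∀ {n m k : ℕ} (h : n + m = k + 1) (i : Fin n) (x : RT K n) (y : RT K m),
      allWeights K k (comp h i x y) =
        (weightedOperad K lam).comp h i (allWeights K n x) (allWeights K m y) := by
    intro n m k h i x y
    funext γ
    rw [weightedOperad_comp_apply, allWeights_apply, allWeights_apply, allWeights_apply, hcomp]
  exact
    { isOperad_source := (weightedOperad_isOperad lam).of_injective (allWeights K)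
        allWeights_injective (allWeights_relabelRT lam) (allWeights_one lam) map_comp
      isOperad_target := weightedOperad_isOperad lam
      map_act := allWeights_relabelRT lam
      map_one := allWeights_one lam
      map_comp := map_comp }

end Operad

theorem mainTheorem4 (K : Type u) [Field K] :
    IsOperadMorphism (preLieOperad K) (weightedOperad K 1) (allWeights K) ∧
      IsOperadMorphism (napOperad K) (weightedOperad K 0) (allWeights K) :=
  ⟨isOperadMorphism_allWeights 1 _ weightedComp_one,
    isOperadMorphism_allWeights 0 _ weightedComp_zero⟩
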